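/- Let $N\ge 1$ and let $\alpha$ be an element of a field of characteristic $0$ that is not a non-positive rational number (for example a real number $\alpha>0$, or an indeterminate over $\mathbb Q$). Polynomials in $z_1,\dots,z_N$ have coefficients in this field, and compositions are elements $\eta=(\eta_1,\dots,\eta_N)\in\mathbb Z_{\ge 0}^N$. **Nonsymmetric Jack polynomials.** Let $s_{ip}$ exchange $z_i$ and $z_p$, and put $$\xi_i=\alpha z_i\frac{\partial}{\partial z_i}+\sum_{p<i}\frac{z_i}{z_i-z_p}(1-s_{ip})+\sum_{p>i}\frac{z_p}{z_i-z_p}(1-s_{ip})+1-i ,$$ $$\bar\eta_i=\alpha\eta_i-\#\{k<i\mid\eta_k\ge\eta_i\}-\#\{k>i\mid\eta_k>\eta_i\}.$$ For $\nu\neq\eta$ with $|\nu|=|\eta|$ write $\nu<\eta$ if $\sum_{j\le p}\nu_j\le\sum_{j\le p}\eta_j$ for all $p$. Let $\eta^+$ be the decreasing rearrangement of $\eta$, and write $\nu\prec\eta$ if $\nu^+<\eta^+$, or $\nu^+=\eta^+$ and $\nu<\eta$. The nonsymmetric Jack polynomial $E_\eta$ is the polynomial of the form $z^\eta+\sum_{\nu\prec\eta}c_{\eta\nu}z^\nu$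 with $\xi_iE_\eta=\bar\eta_iE_\eta$ for all $i$. **Prescribed symmetry.** Let $s_i:=s_{i,i+1}$, and let $I,J\subseteq\{1,\dots,N-1\}$ be disjoint and such that no element of $I$ is a neighbour $j\pm1$ of an element $j\in J$. For $A\subseteq\{1,\dots,N-1\}$ let $W_A=\langle s_i\mid i\in A\rangle$, acting on compositions by $w(\lambda)=(\lambda_{w^{-1}(1)},\dots,\lambda_{w^{-1}(N)})$. For $w\in W_{I\cup J}$ let $\det_J(w)=\pm1$ be the parity of the number of factors $s_j$, $j\in J$, in a decomposition of $w$ into a product of $s_i$, $i\in I\cup J$. Let $\mathcal O_{I,J}$ be the linear operator with $\mathcal O_{I,J}z^\lambda=\sum_{w\in W_{I\cup J}}\det_J(w)\,z^{w(\lambda)}$. Decompose $J$ into maximal sets $J_s$ of consecutive integers, put $\tilde J_s=J_s\cup\{\max J_s+1\}$, and let $\eta$ be a composition with $\eta_j\ne\eta_{j'}$ for all $j\neq j'$ in $\tilde J_s$, for every $s$. For $\epsilon_I,\epsilon_J\in\{+,0,-\}$ let $\eta^{(\epsilon_I,\epsilon_J)}$ be the element $\kappa$ of $W_{I\cup J}(\eta)$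 such that for all $i\in I$: $\kappa_i\ge\kappa_{i+1}$ if $\epsilon_I=+$; $\kappa_i\le\kappa_{i+1}$ if $\epsilon_I=-$; $\kappa_i=\eta_i$ and $\kappa_{i+1}=\eta_{i+1}$ if $\epsilon_I=0$; and for all $j\in J$: $\kappa_j>\kappa_{j+1}$ if $\epsilon_J=+$; $\kappa_j<\kappa_{j+1}$ if $\epsilon_J=-$; $\kappa_j=\eta_j$ and $\kappa_{j+1}=\eta_{j+1}$ if $\epsilon_J=0$. Put $\eta^*=\eta^{(+,+)}$, and let $S_{\eta^*}^{(I,J)}$ be the multiple of $\mathcal O_{I,J}E_{\eta^*}$ in which the coefficient of $z^{\eta^*}$ is $1$. Let $\mathcal M_{I,\eta}=\#\{\sigma\in W_I\mid\sigma(\eta)=\eta\}$ and $$d_\eta=\prod_{i=1}^N\prod_{j=1}^{\eta_i}\bigl(\alpha(\eta_i-j+1)+l(i,j)+1\bigr),\qquad d'_\eta=\prod_{i=1}^N\prod_{j=1}^{\eta_i}\bigl(\alpha(\eta_i-j+1)+l(i,j)\bigr),$$ where $l(i,j)=\#\{k<i\mid j\le\eta_k+1\le\eta_i\}+\#\{k>i\mid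 j\le\eta_k\le\eta_i\}$. **Statement.** The objects above are well defined: $E_\eta$ exists and is unique, each $\eta^{(\epsilon_I,\epsilon_J)}$ exists and is unique, and there is $w_J\in W_J$ with $w_J\eta=\eta^{(0,+)}$. The polynomial $S_{\eta^*}^{(I,J)}$ has the form $z^{\eta^*}+\sum_{\nu\prec\eta^*}\tilde c_\nu z^\nu$, and satisfies $s_iS_{\eta^*}^{(I,J)}=S_{\eta^*}^{(I,J)}$ for $i\in I$ and $s_jS_{\eta^*}^{(I,J)}=-S_{\eta^*}^{(I,J)}$ for $j\in J$. Moreover $$\mathcal O_{I,J}E_\eta=a_\eta^{(I,J)}\,S_{\eta^*}^{(I,J)},\qquad a_\eta^{(I,J)}=\det\nolimits_J(w_J)\,\mathcal M_{I,\eta}\,\frac{d'_\eta\,d'_{\eta^{(-,+)}}\,d_{\eta^{(-,+)}}}{d'_{\eta^{(0,+)}}\,d_{\eta^{(0,+)}}\,d'_{\eta^{(-,-)}}}$$ for every $w_J\in W_J$ with $w_J\eta=\eta^{(0,+)}$. -/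

import Mathlib

open MvPolynomial

namespace PrescribedJack

noncomputable section

variable {K : Type*} [Field K]

/-! ### Cherednik operators and nonsymmetric Jack polynomials -/

/-- `z_i - z_p` divides `f - s_{ip} f`. -/
theorem sub_dvd_sub_swap {N : ℕ} (i p : Fin N) (f : MvPolynomial (Fin N) K) :
    (X i - X p : MvPolynomial (Fin N) K) ∣ f - rename (Equiv.swap i p) f := by
  induction f using MvPolynomial.induction_on with
  | C a => simp
  | add f g hf hg =>
    have h := dvd_add hf hg
    rw [map_add]
    convert h using 1
    ring
  | mul_X f k hf =>
    have hk : (X i - X p : MvPolynomial (Fin N) K) ∣ X k - X (Equiv.swap i p k) := by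
      rcases eq_or_ne k i with rfl | hi
      · simp
      · rcases eq_or_ne k p with rfl | hp
        · rw [Equiv.swap_apply_right, ← neg_sub (X i) (X k)]
          exact (dvd_refl _).neg_right
        · rw [Equiv.swap_apply_of_ne_of_ne hi hp, sub_self]
          exact dvd_zero _
    have h := dvd_add (hf.mul_right (X k)) (hk.mul_left (rename (Equiv.swap i p) f))
    rw [map_mul, rename_X]
    convert h using 1
    ring

/-- The divided difference `(z_i - z_p)⁻¹ (1 - s_{ip}) f`, for `i ≠ p`. -/
def divDiff {N : ℕ} (i p : Fin N) (f : MvPolynomial (Fin N) K) : MvPolynomial (Fin N) K :=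
  (sub_dvd_sub_swap i p f).choose

theorem divDiff_spec {N : ℕ} (i p : Fin N) (f : MvPolynomial (Fin N) K) :
    (X i - X p) * divDiff i p f = f - rename (Equiv.swap i p) f :=
  (sub_dvd_sub_swap i p f).choose_spec.symm

/-- The type `A` Cherednik operator
`ξ_i = α z_i ∂_i + ∑_{p<i} z_i/(z_i-z_p) (1-s_{ip}) + ∑_{p>i} z_p/(z_i-z_p) (1-s_{ip}) + 1 - i`.
Indices start at `0` here, so that the constant `1 - i` becomes `-i`. -/
def cherednik {N : ℕ} (α : K) (i : Fin N) (f : MvPolynomial (Fin N) K) :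
    MvPolynomial (Fin N) K :=
  C α * X i * pderiv i f
    + ∑ p ∈ Finset.univ.filter (fun p => p < i), X i * divDiff i p f
    + ∑ p ∈ Finset.univ.filter (fun p => i < p), X p * divDiff i p f
    - C (i.val : K) * f

/-- `η̄_i = α η_i - #{k < i | η_k ≥ η_i} - #{k > i | η_k > η_i}`. -/
def eigenvalue {N : ℕ} (α : K) (η : Fin N →₀ ℕ) (i : Fin N) : K :=
  α * (η i : K)
    - ((Finset.univ.filter (fun k => k < i ∧ η i ≤ η k)).card : K)
    - ((Finset.univ.filter (fun k => i < k ∧ η i < η k)).card : K)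

/-- The (strict) dominance ordering on sequences with equal sums. -/
def Dominated {N : ℕ} (ν η : Fin N → ℕ) : Prop :=
  ν ≠ η ∧ ∑ j, ν j = ∑ j, η j ∧
    ∀ p : Fin N, ∑ j ∈ Finset.univ.filter (fun j => j ≤ p), ν j
      ≤ ∑ j ∈ Finset.univ.filter (fun j => j ≤ p), η j

/-- The partition `η⁺`: the entries of `η` in weakly decreasing order. -/
def sortDesc {N : ℕ} (η : Fin N → ℕ) : Fin N → ℕ :=
  fun i => η (Tuple.sort η i.rev)

/-- `ν ≺ η`: either `ν⁺ < η⁺`, or `ν⁺ = η⁺` and `ν < η`, in the dominance ordering. -/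
def Precedes {N : ℕ} (ν η : Fin N →₀ ℕ) : Prop :=
  Dominated (sortDesc ν) (sortDesc η) ∨ (sortDesc ν = sortDesc η ∧ Dominated ν η)

/-- `P = z^η + ∑_{ν ≺ η} c_ν z^ν`. -/
def IsMonicTriangular {N : ℕ} (η : Fin N →₀ ℕ) (P : MvPolynomial (Fin N) K) : Prop :=
  coeff η P = 1 ∧ ∀ ν, ν ≠ η → coeff ν P ≠ 0 → Precedes ν η

/-- The characterization of the nonsymmetric Jack polynomial `E_η(z; α)`. -/
def IsNonsymJack {N : ℕ} (α : K) (η : Fin N →₀ ℕ) (P : MvPolynomial (Fin N) K) : Prop :=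
  IsMonicTriangular η P ∧ ∀ i, cherednik α i P = C (eigenvalue α η i) * P

/-- The nonsymmetric Jack polynomial `E_η(z; α)`: the polynomial that satisfies its
characterization. -/
def nonsymJack {N : ℕ} (α : K) (η : Fin N →₀ ℕ) : MvPolynomial (Fin N) K :=
  Classical.epsilon (IsNonsymJack α η)

/-! ### Diagram products -/

/-- The leg length `l(i,j) = #{k < i | j ≤ η_k + 1 ≤ η_i} + #{k > i | j ≤ η_k ≤ η_i}`. -/
def leg {N : ℕ} (η : Fin N →₀ ℕ) (i : Fin N) (j : ℕ) : ℕ :=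
  (Finset.univ.filter (fun k => k < i ∧ j ≤ η k + 1 ∧ η k + 1 ≤ η i)).card
    + (Finset.univ.filter (fun k => i < k ∧ j ≤ η k ∧ η k ≤ η i)).card

/-- `d_η = ∏_{(i,j) ∈ η} (α (a(i,j) + 1) + l(i,j) + 1)` with arm length `a(i,j) = η_i - j`. -/
def d {N : ℕ} (α : K) (η : Fin N →₀ ℕ) : K :=
  ∏ i, ∏ j ∈ Finset.Icc 1 (η i), (α * (((η i - j : ℕ) : K) + 1) + (leg η i j : K) + 1)

/-- `d'_η = ∏_{(i,j) ∈ η} (α (a(i,j) + 1) + l(i,j))`. -/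
def d' {N : ℕ} (α : K) (η : Fin N →₀ ℕ) : K :=
  ∏ i, ∏ j ∈ Finset.Icc 1 (η i), (α * (((η i - j : ℕ) : K) + 1) + (leg η i j : K))

/-! ### Symmetrization and antisymmetrization

There are `N = n + 1` variables; the set `{1, …, N - 1}` of simple transpositions is `Fin n`. -/

/-- The simple transposition exchanging the neighbouring positions `i` and `i + 1`. -/
def simple {n : ℕ} (i : Fin n) : Equiv.Perm (Fin (n + 1)) :=
  Equiv.swap i.castSucc i.succ

/-- `W_A`, the group generated by the `s_i` with `i ∈ A`. -/
def parabolic {n : ℕ} (A : Finset (Fin n)) : Subgroup (Equiv.Perm (Fin (n + 1))) :=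
  Subgroup.closure (simple '' (A : Set (Fin n)))

/-- `w(η) = (η_{w⁻¹(1)}, …, η_{w⁻¹(N)})`. -/
def act {N : ℕ} (w : Equiv.Perm (Fin N)) (η : Fin N →₀ ℕ) : Fin N →₀ ℕ :=
  Finsupp.equivMapDomain w η

open Classical in
/-- `det_J(w)` for `w ∈ W_{I ∪ J}`: it is `1` or `-1` according to whether the number of factors
`s_j` with `j ∈ J` is even or odd, in a decomposition of `w` into a product of `s_i`,
`i ∈ I ∪ J`. -/
def detJ {n : ℕ} (I J : Finset (Fin n)) (w : Equiv.Perm (Fin (n + 1))) : ℤ :=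
  if ∃ l : List (Fin n), (∀ i ∈ l, i ∈ I ∪ J) ∧ (l.map simple).prod = w ∧
      Even (l.countP (fun i => i ∈ J))
  then 1 else -1

open Classical in
/-- `O_{I,J} f = ∑_{w ∈ W_{I ∪ J}} det_J(w) w f`, where `w z^λ = z^{w(λ)}`. -/
def symAsym {n : ℕ} (I J : Finset (Fin n)) (f : MvPolynomial (Fin (n + 1)) K) :
    MvPolynomial (Fin (n + 1)) K :=
  ∑ w ∈ Finset.univ.filter (fun w => w ∈ parabolic (I ∪ J)),
    C ((detJ I J w : ℤ) : K) * rename w f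

/-- `M_{I,η} = #{σ ∈ W_I | σ(η) = η}`. -/
def stabCard {n : ℕ} (I : Finset (Fin n)) (η : Fin (n + 1) →₀ ℕ) : ℕ :=
  Nat.card {σ : Equiv.Perm (Fin (n + 1)) // σ ∈ parabolic I ∧ act σ η = η}

/-- `I` and `J` are disjoint, and no element of `I` is a neighbour of an element of `J`. -/
def Separated {n : ℕ} (I J : Finset (Fin n)) : Prop :=
  ∀ i ∈ I, ∀ j ∈ J, i ≠ j ∧ i.val + 1 ≠ j.val ∧ j.val + 1 ≠ i.val

/-- The entries of `η` are pairwise distinct on each block `J̃_s = J_s ∪ {max J_s + 1}`, where the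
`J_s` are the maximal sets of consecutive integers in `J`. Positions `a < b` are in the same block
when all of `a, …, b - 1` are in `J`. -/
def DistinctOnBlocks {n : ℕ} (J : Finset (Fin n)) (η : Fin (n + 1) →₀ ℕ) : Prop :=
  ∀ a b : Fin (n + 1), a < b →
    (∀ k : Fin n, a ≤ k.castSucc → k.castSucc < b → k ∈ J) → η a ≠ η b

/-- The condition imposed on `κ = η^{(ε, ·)}` by the first sign. -/
def OrderedOnI {n : ℕ} (I : Finset (Fin n)) (η κ : Fin (n + 1) →₀ ℕ) : SignType → Prop
  | .pos => ∀ i ∈ I, κ i.castSucc ≥ κ i.succ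
  | .neg => ∀ i ∈ I, κ i.castSucc ≤ κ i.succ
  | .zero => ∀ i ∈ I, κ i.castSucc = η i.castSucc ∧ κ i.succ = η i.succ

/-- The condition imposed on `κ = η^{(·, ε)}` by the second sign. -/
def OrderedOnJ {n : ℕ} (J : Finset (Fin n)) (η κ : Fin (n + 1) →₀ ℕ) : SignType → Prop
  | .pos => ∀ j ∈ J, κ j.castSucc > κ j.succ
  | .neg => ∀ j ∈ J, κ j.castSucc < κ j.succ
  | .zero => ∀ j ∈ J, κ j.castSucc = η j.castSucc ∧ κ j.succ = η j.succ

/-- The properties that single out `κ = η^{(ε_I, ε_J)}`. -/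
def IsRearranged {n : ℕ} (I J : Finset (Fin n)) (η : Fin (n + 1) →₀ ℕ) (εI εJ : SignType)
    (κ : Fin (n + 1) →₀ ℕ) : Prop :=
  (∃ w ∈ parabolic (I ∪ J), κ = act w η) ∧ OrderedOnI I η κ εI ∧ OrderedOnJ J η κ εJ

/-- The composition `η^{(ε_I, ε_J)}`. -/
def rearranged {n : ℕ} (I J : Finset (Fin n)) (η : Fin (n + 1) →₀ ℕ) (εI εJ : SignType) :
    Fin (n + 1) →₀ ℕ :=
  Classical.epsilon (IsRearranged I J η εI εJ)

/-- `η*`, the element of `W_{I ∪ J}(η)` that is weakly decreasing along `I` and strictly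
decreasing along `J`. -/
def etaStar {n : ℕ} (I J : Finset (Fin n)) (η : Fin (n + 1) →₀ ℕ) : Fin (n + 1) →₀ ℕ :=
  rearranged I J η .pos .pos

/-- The Jack polynomial with prescribed symmetry `S_κ^{(I,J)}`, for `κ` weakly decreasing along
`I` and strictly decreasing along `J`: the polynomial `O_{I,J} E_κ`, normalized so that the
coefficient of `z^κ` is `1`. -/
def prescribedJack {n : ℕ} (α : K) (I J : Finset (Fin n)) (κ : Fin (n + 1) →₀ ℕ) :
    MvPolynomial (Fin (n + 1)) K :=
  C (coeff κ (symAsym I J (nonsymJack α κ)))⁻¹ * symAsym I J (nonsymJack α κ)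

end

end PrescribedJack

open PrescribedJack

/-! The hypothesis `hα` says that no `aα + b` with `a > 0`, `b ≥ 0` vanishes, i.e. that `α` is not a
non-positive rational. Everything generic about the spectrum comes from it: the joint eigenvalues
separate compositions (`eigenvalue_injective`), and the difference `δ` of the eigenvalues at a
larger and a smaller entry avoids `0`, `1` and `-1`. The operators `ξ_i` are triangular on monomials
(`cherednik_monomial_sub_mem`), so a joint eigenvector with the eigenvalues of `η` has `z^η` as its
top monomial; this gives uniqueness. Existence comes from building eigenvectors with two moves: the
raising operator, which increases the degree, and the intertwiners `s_a + δ⁻¹`, which exchange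
neighbouring entries (`exists_eigenvector`). Commuting the `ξ_i` themselves is never needed. The
intertwiners also give the action of `s_a` on the `E_η`. For `η_a < η_{a+1}` one has `s_a E_η =
E_{s_aη} - δ⁻¹ E_η`. Applying `O_{I,J}`, which absorbs `s_a` into the sign `±1`, shows that `O
E_{s_aη}` equals `(±1 + δ⁻¹) O E_η`. A single box of the diagram changes its leg under `s_a`, and
its factor is built from `δ`; hence `1 + δ⁻¹` is a ratio of values of `d` and `-1 + δ⁻¹` is minus a
ratio of values of `d'`. So along a `W_I`-orbit `d_η O E_η` is constant, and along a `W_J`-orbit `O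
E_η` is proportional to `d'_η` up to sign (`symAsym_nonsymJack_act_left`,
`symAsym_nonsymJack_act_right`). It remains to fix one constant. For the smallest composition
`η^{(-,-)}` of the orbit no other monomial of the orbit occurs in `E`, so the coefficient of
`z^{η*}` in `O E_{η^{(-,-)}}` is a signed count of permutations, namely `± M_{I,η}`
(`coeff_symAsym_nonsymJack`). Transporting this to `η*` and to `η` gives `a_η`. -/

namespace PrescribedJack

variable {K : Type*} [Field K] {N : ℕ}

/-! ### Ranks and eigenvalues -/

/-- `k` comes before `i` when the positions are listed by decreasing entries of `η`, equal entries
from left to right. -/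
abbrev Before (η : Fin N →₀ ℕ) (k i : Fin N) : Prop := η i < η k ∨ (η k = η i ∧ k < i)

/-- The number of positions that come before `i`. -/
def rank (η : Fin N →₀ ℕ) (i : Fin N) : ℕ := (Finset.univ.filter (fun k => Before η k i)).card

/-- The two counts in the eigenvalue split the positions before `i` into those on its left and those
on its right. -/
theorem eigenvalue_eq (α : K) (η : Fin N →₀ ℕ) (i : Fin N) :
    eigenvalue α η i = α * (η i : K) - (rank η i : K) := by
  have h : rank η i = (Finset.univ.filter (fun k => k < i ∧ η i ≤ η k)).card
      + (Finset.univ.filter (fun k => i < k ∧ η i < η k)).card := by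
    unfold rank
    simp only [Finset.card_filter, ← Finset.sum_add_distrib]
    refine Finset.sum_congr rfl fun k _ => ?_
    rcases lt_trichotomy k i with h | rfl | h
    · have h1 : ¬ i < k := h.not_gt
      have h2 : Before η k i ↔ η i ≤ η k := by
        unfold Before; constructor
        · rintro (h | h) <;> omega
        · intro h'; rcases h'.lt_or_eq with h' | h'
          · exact Or.inl h'
          · exact Or.inr ⟨h'.symm, h⟩
      simp [h, h1, h2]
    · simp
    · have h1 : ¬ k < i := h.not_gt
      have h2 : Before η k i ↔ η i < η k := by simp [Before, h1]
      simp only [h, h1, h2, false_and, true_and, if_false, zero_add]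
  rw [eigenvalue, h]
  push_cast
  ring

theorem Before.trans {η : Fin N →₀ ℕ} {i j k : Fin N} (h : Before η i j) (h' : Before η j k) :
    Before η i k := by
  rcases h with h | ⟨h, h1⟩ <;> rcases h' with h' | ⟨h', h2⟩
  · exact Or.inl (h'.trans h)
  · exact Or.inl (h' ▸ h)
  · exact Or.inl (h ▸ h')
  · exact Or.inr ⟨h.trans h', h1.trans h2⟩

theorem Before.irrefl {η : Fin N →₀ ℕ} {i : Fin N} : ¬ Before η i i := by
  simp [Before]

theorem rank_lt_rank {η : Fin N →₀ ℕ} {k i : Fin N} (h : Before η k i) : rank η k < rank η i := by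
  apply Finset.card_lt_card
  refine ⟨fun x hx => ?_, fun hsub => ?_⟩
  · simp only [Finset.mem_filter, Finset.mem_univ, true_and] at hx ⊢
    exact hx.trans h
  · have := @hsub k (by simpa using h)
    exact Before.irrefl (by simpa using this)

/-- The eigenvalues at positions with different entries differ by `m α + c`, `m, c > 0`. -/
theorem exists_eigenvalue_sub (α : K) {η : Fin N →₀ ℕ} {a b : Fin N} (h : η a < η b) :
    ∃ m c : ℕ, 0 < m ∧ 0 < c ∧ eigenvalue α η b - eigenvalue α η a = (m : K) * α + (c : K) := by
  have hr : rank η b < rank η a := rank_lt_rank (Or.inl h)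
  refine ⟨η b - η a, rank η a - rank η b, by omega, by omega, ?_⟩
  rw [eigenvalue_eq, eigenvalue_eq, Nat.cast_sub h.le, Nat.cast_sub hr.le]
  ring

theorem eigenvalue_sub_ne_zero {α : K} (hα : ∀ a b : ℕ, 0 < a → (a : K) * α + (b : K) ≠ 0)
    {η : Fin N →₀ ℕ} {a b : Fin N} (h : η a < η b) :
    eigenvalue α η b - eigenvalue α η a ≠ 0 := by
  obtain ⟨m, c, hm, -, h⟩ := exists_eigenvalue_sub α h
  rw [h]; exact hα m c hm

theorem eigenvalue_sub_add_one_ne_zero {α : K}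
    (hα : ∀ a b : ℕ, 0 < a → (a : K) * α + (b : K) ≠ 0)
    {η : Fin N →₀ ℕ} {a b : Fin N} (h : η a < η b) :
    eigenvalue α η b - eigenvalue α η a + 1 ≠ 0 := by
  obtain ⟨m, c, hm, -, h⟩ := exists_eigenvalue_sub α h
  rw [h]
  have := hα m (c + 1) hm
  push_cast at this
  rwa [add_assoc]

theorem eigenvalue_sub_sub_one_ne_zero {α : K}
    (hα : ∀ a b : ℕ, 0 < a → (a : K) * α + (b : K) ≠ 0)
    {η : Fin N →₀ ℕ} {a b : Fin N} (h : η a < η b) :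
    eigenvalue α η b - eigenvalue α η a - 1 ≠ 0 := by
  obtain ⟨m, c, hm, hc, h⟩ := exists_eigenvalue_sub α h
  rw [h]
  -- The subtracted `1` is absorbed because `c ≥ 1`: the larger entry comes strictly earlier in the
  -- listing.
  have := hα m (c - 1) hm
  rw [Nat.cast_sub hc, Nat.cast_one] at this
  rwa [add_sub_assoc]

theorem lt_rank_of_eigenvalue_eq {α : K} (hα : ∀ a b : ℕ, 0 < a → (a : K) * α + (b : K) ≠ 0)
    {η ν : Fin N →₀ ℕ} {i : Fin N} (h : eigenvalue α η i = eigenvalue α ν i) (hlt : ν i < η i) :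
    rank ν i < rank η i := by
  by_contra! hle
  refine hα (η i - ν i) (rank ν i - rank η i) (by omega) ?_
  rw [Nat.cast_sub hlt.le, Nat.cast_sub hle]
  rw [eigenvalue_eq, eigenvalue_eq] at h
  linear_combination h

/-- The joint eigenvalues separate the compositions. -/
theorem eigenvalue_injective {α : K} (hα : ∀ a b : ℕ, 0 < a → (a : K) * α + (b : K) ≠ 0)
    {η ν : Fin N →₀ ℕ} (h : ∀ i, eigenvalue α η i = eigenvalue α ν i) : η = ν := by
  by_contra hne
  let D := Finset.univ.filter (fun i => η i ≠ ν i)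
  have hD : D.Nonempty := by
    obtain ⟨i, hi⟩ := Finsupp.ne_iff.mp hne
    exact ⟨i, by simpa [D] using hi⟩
  -- Among the positions where `η` and `ν` differ, take the one with the largest value of `max (η i)
  -- (ν i)`, the leftmost in case of ties.
  let key : Fin N → ℕ ×ₗ (Fin N)ᵒᵈ := fun i => toLex (max (η i) (ν i), OrderDual.toDual i)
  obtain ⟨i, hiD, hmax⟩ := Finset.exists_max_image D key hD
  -- If `ν i < η i`, equal eigenvalues force `rank ν i < rank η i`. By the extremal choice of `i`,
  -- every position before `i` for `η` is also before `i` for `ν`, which gives the opposite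
  -- inequality.
  have main : ∀ η ν : Fin N →₀ ℕ, (∀ i, eigenvalue α η i = eigenvalue α ν i) → ν i < η i →
      (∀ k, η k ≠ ν k → max (η k) (ν k) < η i ∨ (max (η k) (ν k) = η i ∧ i ≤ k)) → False := by
    intro η ν h hlt hm
    refine (lt_rank_of_eigenvalue_eq hα (h i) hlt).not_ge ?_
    apply Finset.card_le_card
    intro k hk
    simp only [Finset.mem_filter, Finset.mem_univ, true_and] at hk ⊢
    left
    by_cases hkD : η k = ν k
    · rcases hk with hk | hk <;> omega
    · rcases hm k hkD with h1 | ⟨h1, h2⟩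
      · rcases hk with hk | hk <;> omega
      · rcases hk with hk | ⟨-, hk⟩
        · omega
        · exact absurd hk h2.not_gt
  have hne' : η i ≠ ν i := by simpa [D] using hiD
  have hm : ∀ k, η k ≠ ν k → max (η k) (ν k) < max (η i) (ν i) ∨
      (max (η k) (ν k) = max (η i) (ν i) ∧ i ≤ k) := by
    intro k hk
    have := hmax k (by simpa [D] using hk)
    simpa [key, Prod.Lex.toLex_le_toLex] using this
  rcases hne'.lt_or_gt with hlt | hlt
  · refine main ν η (fun i => (h i).symm) hlt fun k hk => ?_
    have := hm k hk.symm
    rwa [max_eq_right hlt.le, max_comm] at this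
  · refine main η ν h hlt fun k hk => ?_
    have := hm k hk
    rwa [max_eq_left hlt.le] at this

end PrescribedJack

namespace PrescribedJack

variable {N : ℕ}

/-! ### Dominance -/

/-- `f 0 + ⋯ + f p`. -/
def partialSum {M : Type*} [AddCommMonoid M] (f : Fin N → M) (p : Fin N) : M :=
  ∑ j ∈ Finset.univ.filter (fun j => j ≤ p), f j

theorem partialSum_injective {M : Type*} [AddCancelCommMonoid M] {f g : Fin N → M}
    (h : ∀ p, partialSum f p = partialSum g p) : f = g := by
  have key : ∀ (f : Fin N → M) (p : Fin N),
      partialSum f p = f p + ∑ j ∈ Finset.univ.filter (fun j => j < p), f j := by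
    intro f p
    have : Finset.univ.filter (fun j => j ≤ p)
        = insert p (Finset.univ.filter (fun j => j < p)) := by
      ext j; simp [le_iff_eq_or_lt]
    rw [partialSum, this, Finset.sum_insert (by simp)]
  funext p
  induction p using WellFoundedLT.induction with
  | ind p ih =>
    have hp := h p
    rw [key, key, Finset.sum_congr rfl fun j hj => ih j (by simpa using hj)] at hp
    exact add_right_cancel hp

/-- Exchanging elements of `S` below a threshold against as many elements of `T` above it does not
decrease the sum. -/
theorem sum_le_sum_of_threshold {ι : Type*} [DecidableEq ι] {S T : Finset ι} (f : ι → ℤ) (c : ℤ)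
    (hcard : S.card = T.card) (hS : ∀ x ∈ S, x ∉ T → f x ≤ c) (hT : ∀ x ∈ T, x ∉ S → c ≤ f x) :
    ∑ x ∈ S, f x ≤ ∑ x ∈ T, f x := by
  have h1 := Finset.sum_inter_add_sum_sdiff S T f
  have h2 := Finset.sum_inter_add_sum_sdiff T S f
  have h3 : (S \ T).card = (T \ S).card := Finset.card_sdiff_comm hcard
  have h4 := Finset.sum_le_card_nsmul (S \ T) f c
    (fun x hx => hS x (Finset.mem_sdiff.mp hx).1 (Finset.mem_sdiff.mp hx).2)
  have h5 := Finset.card_nsmul_le_sum (T \ S) f c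
    (fun x hx => hT x (Finset.mem_sdiff.mp hx).1 (Finset.mem_sdiff.mp hx).2)
  rw [Finset.inter_comm] at h2
  rw [h3] at h4
  linarith

theorem Dominated.trans {f g h : Fin N → ℕ} (h1 : Dominated f g) (h2 : Dominated g h) :
    Dominated f h := by
  refine ⟨?_, h1.2.1.trans h2.2.1, fun p => (h1.2.2 p).trans (h2.2.2 p)⟩
  rintro rfl
  exact h1.1 (partialSum_injective fun p => le_antisymm (h1.2.2 p) (h2.2.2 p))

theorem Precedes.trans {f g h : Fin N →₀ ℕ} (h1 : Precedes f g) (h2 : Precedes g h) :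
    Precedes f h := by
  rcases h1 with h1 | ⟨h1, h1'⟩ <;> rcases h2 with h2 | ⟨h2, h2'⟩
  · exact Or.inl (h1.trans h2)
  · exact Or.inl (h2 ▸ h1)
  · exact Or.inl (h1 ▸ h2)
  · exact Or.inr ⟨h1.trans h2, h1'.trans h2'⟩

theorem Precedes.irrefl {f : Fin N →₀ ℕ} : ¬ Precedes f f := by
  rintro (h | ⟨-, h⟩) <;> exact h.1 rfl

theorem sortDesc_comp_perm (f : Fin N → ℕ) (σ : Equiv.Perm (Fin N)) :
    sortDesc (f ∘ σ) = sortDesc f := by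
  funext i
  exact congrFun (Tuple.comp_perm_comp_sort_eq_comp_sort (f := f) (σ := σ)) i.rev

theorem sortDesc_antitone (f : Fin N → ℕ) : Antitone (sortDesc f) := fun _ _ h =>
  Tuple.monotone_sort f (Fin.rev_le_rev.mpr h)

/-- The permutation that sorts `f` decreasingly. -/
theorem exists_sortDesc_eq_comp (f : Fin N → ℕ) : ∃ σ : Equiv.Perm (Fin N), sortDesc f = f ∘ σ :=
  ⟨Fin.revPerm.trans (Tuple.sort f), rfl⟩

/-- The partial sum of the sorted sequence is the sum of its largest entries. With
`exists_partialSum_sortDesc_eq` this makes it a maximum over subsets of fixed size, so dominance of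
sorted sequences can be proved without following the sorting. -/
theorem sum_le_partialSum_sortDesc (f : Fin N → ℕ) (p : Fin N) (S : Finset (Fin N))
    (hS : S.card = (Finset.univ.filter (fun j => j ≤ p)).card) :
    ∑ x ∈ S, f x ≤ partialSum (sortDesc f) p := by
  obtain ⟨σ, hσ⟩ := exists_sortDesc_eq_comp f
  have h1 : ∑ x ∈ S, f x = ∑ x ∈ S.map σ.symm.toEmbedding, sortDesc f x := by
    simp [hσ]
  have h2 := sum_le_sum_of_threshold (S := S.map σ.symm.toEmbedding)
    (T := Finset.univ.filter (fun j => j ≤ p)) (fun x => (sortDesc f x : ℤ)) (sortDesc f p)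
    (by simpa using hS) (fun x _ hx => ?_) (fun x hx _ => ?_)
  · rw [h1, partialSum]; exact_mod_cast h2
  · exact_mod_cast sortDesc_antitone f (by simpa using hx : p < x).le
  · exact_mod_cast sortDesc_antitone f (by simpa using hx : x ≤ p)

theorem exists_partialSum_sortDesc_eq (f : Fin N → ℕ) (p : Fin N) :
    ∃ S : Finset (Fin N), S.card = (Finset.univ.filter (fun j => j ≤ p)).card ∧
      partialSum (sortDesc f) p = ∑ x ∈ S, f x := by
  obtain ⟨σ, hσ⟩ := exists_sortDesc_eq_comp f
  exact ⟨(Finset.univ.filter (fun j => j ≤ p)).map σ.toEmbedding, by simp, by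
    rw [hσ, partialSum, Finset.sum_map]; rfl⟩

theorem sum_sortDesc (f : Fin N → ℕ) (g : ℕ → ℕ) : ∑ i, g (sortDesc f i) = ∑ i, g (f i) := by
  obtain ⟨σ, hσ⟩ := exists_sortDesc_eq_comp f
  rw [hσ]; exact Equiv.sum_comp σ (fun i => g (f i))

theorem sum_eq_add_add_sum_erase {ι M : Type*} [DecidableEq ι] [AddCommMonoid M] {S : Finset ι}
    {i p : ι} (hip : i ≠ p) (hi : i ∈ S) (hp : p ∈ S) (f : ι → M) :
    ∑ x ∈ S, f x = f i + (f p + ∑ x ∈ (S.erase i).erase p, f x) := by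
  rw [Finset.add_sum_erase _ _ (Finset.mem_erase.mpr ⟨hip.symm, hp⟩), Finset.add_sum_erase _ _ hi]

/-- Moving two entries closer together gives a smaller composition. -/
theorem precedes_of_between {ν η : Fin N →₀ ℕ} {i p : Fin N} (hip : i ≠ p)
    (hsum : ν i + ν p = η i + η p) (h1 : η p < ν i) (h2 : ν i < η i)
    (hrest : ∀ x, x ≠ i → x ≠ p → ν x = η x) : Precedes ν η := by
  have hcongr : ∀ (S : Finset (Fin N)) (g : ℕ → ℕ),
      ∑ x ∈ (S.erase i).erase p, g (ν x) = ∑ x ∈ (S.erase i).erase p, g (η x) := by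
    intro S g
    refine Finset.sum_congr rfl fun x hx => ?_
    rw [hrest x (by simp_all) (by simp_all)]
  left
  refine ⟨fun h => ?_, ?_, fun q => ?_⟩
  -- The sum of squares depends only on the sorted sequence, and bringing two entries closer
  -- together strictly decreases it.
  · have hsq : ∑ x, (ν x) ^ 2 = ∑ x, (η x) ^ 2 := by
      rw [← sum_sortDesc ν (fun x => x ^ 2), ← sum_sortDesc η (fun x => x ^ 2), h]
    rw [sum_eq_add_add_sum_erase hip (Finset.mem_univ _) (Finset.mem_univ _),
      sum_eq_add_add_sum_erase hip (Finset.mem_univ _) (Finset.mem_univ _) (fun x => η x ^ 2),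
      hcongr Finset.univ (fun x => x ^ 2), ← add_assoc, ← add_assoc] at hsq
    have hsq := add_right_cancel hsq
    have : η p < ν p := by omega
    zify at *
    nlinarith
  · have e1 := sum_sortDesc ν id
    have e2 := sum_sortDesc η id
    simp only [id] at e1 e2
    have e3 := hcongr Finset.univ id
    simp only [id] at e3
    rw [e1, e2,
      sum_eq_add_add_sum_erase hip (Finset.mem_univ _) (Finset.mem_univ _),
      sum_eq_add_add_sum_erase hip (Finset.mem_univ _) (Finset.mem_univ _) (fun x => η x),
      e3, ← add_assoc, ← add_assoc, hsum]
  · obtain ⟨S, hS, hSsum⟩ := exists_partialSum_sortDesc_eq ν q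
    change partialSum (sortDesc ν) q ≤ partialSum (sortDesc η) q
    rw [hSsum]
    by_cases hiS : i ∈ S
    · refine le_trans ?_ (sum_le_partialSum_sortDesc η q S hS)
      by_cases hpS : p ∈ S
      · rw [sum_eq_add_add_sum_erase hip hiS hpS,
          sum_eq_add_add_sum_erase hip hiS hpS (fun x => η x)]
        have := hcongr S id
        simp only [id] at this
        omega
      · refine Finset.sum_le_sum fun x hx => ?_
        by_cases hxi : x = i
        · subst hxi; exact h2.le
        · exact (hrest x hxi (fun h => hpS (h ▸ hx))).le
    · by_cases hpS : p ∈ S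
      -- If `S` contains only `p`, the bound `ν p ≤ η p` may fail; trading `p` for `i` keeps the
      -- size, and `ν p ≤ η i`.
      · have hcard : (insert i (S.erase p)).card = S.card := by
          rw [Finset.card_insert_of_notMem (by simp [hiS]), Finset.card_erase_add_one hpS]
        refine le_trans ?_ (sum_le_partialSum_sortDesc η q (insert i (S.erase p)) (hcard.trans hS))
        rw [Finset.sum_insert (by simp [hiS]), ← Finset.add_sum_erase _ _ hpS]
        refine add_le_add (by omega) (Finset.sum_le_sum fun x hx => ?_)
        refine (hrest x ?_ ?_).le
        · rintro rfl; simp_all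
        · rintro rfl; simp_all
      · refine le_trans ?_ (sum_le_partialSum_sortDesc η q S hS)
        refine Finset.sum_le_sum fun x hx => (hrest x ?_ ?_).le
        · rintro rfl; exact hiS hx
        · rintro rfl; exact hpS hx

/-! ### Permutations acting on compositions -/

@[simp] theorem act_apply (w : Equiv.Perm (Fin N)) (η : Fin N →₀ ℕ) (i : Fin N) :
    act w η i = η (w.symm i) := rfl

theorem act_mul (v w : Equiv.Perm (Fin N)) (η : Fin N →₀ ℕ) : act (v * w) η = act v (act w η) := by
  ext i; rfl

@[simp] theorem act_one (η : Fin N →₀ ℕ) : act 1 η = η := by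
  ext i; rfl

theorem sortDesc_act (w : Equiv.Perm (Fin N)) (η : Fin N →₀ ℕ) :
    sortDesc (act w η) = sortDesc η :=
  sortDesc_comp_perm η w.symm

theorem sum_act (w : Equiv.Perm (Fin N)) (η : Fin N →₀ ℕ) : ∑ i, act w η i = ∑ i, η i :=
  Equiv.sum_comp w.symm η

/-- Moving the larger of two entries to the right gives a smaller composition. -/
theorem precedes_act_swap {η : Fin N →₀ ℕ} {i p : Fin N} (hip : i < p) (h : η p < η i) :
    Precedes (act (Equiv.swap i p) η) η := by
  right
  refine ⟨sortDesc_act _ _, fun hne => ?_, sum_act _ _, fun q => ?_⟩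
  · have := congrFun hne i
    simp at this
    omega
  · by_cases hpq : p ≤ q
    · have hi : i ∈ Finset.univ.filter (fun j => j ≤ q) := by simpa using hip.le.trans hpq
      have hp : p ∈ Finset.univ.filter (fun j => j ≤ q) := by simpa using hpq
      rw [sum_eq_add_add_sum_erase hip.ne hi hp, sum_eq_add_add_sum_erase hip.ne hi hp (fun x => η x)]
      have : ∀ x ∈ ((Finset.univ.filter (fun j => j ≤ q)).erase i).erase p,
          act (Equiv.swap i p) η x = η x := by
        intro x hx
        simp only [Finset.mem_erase] at hx
        simp [Equiv.swap_apply_of_ne_of_ne hx.2.1 hx.1]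
      rw [Finset.sum_congr rfl this]
      simpa using (add_left_comm _ _ _).le
    · refine Finset.sum_le_sum fun x hx => ?_
      have hxp : x ≠ p := by
        rintro rfl; simp at hx; exact hpq hx
      by_cases hxi : x = i
      · subst hxi; simpa using h.le
      · simp [Equiv.swap_apply_of_ne_of_ne hxi hxp]

end PrescribedJack

namespace PrescribedJack

variable {K : Type*} [Field K] {N : ℕ}

/-! ### Divided differences and the action of the Cherednik operators on monomials -/

theorem X_sub_X_ne_zero {i p : Fin N} (h : i ≠ p) : (X i - X p : MvPolynomial (Fin N) K) ≠ 0 :=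
  sub_ne_zero.mpr fun h' => h (X_injective h')

/-- `z_i - z_p` can be cancelled. Since `divDiff` is only a chosen quotient, its identities are
checked through this lemma after multiplication by `z_i - z_p`. -/
theorem divDiff_unique {i p : Fin N} (h : i ≠ p) {f g : MvPolynomial (Fin N) K}
    (hg : (X i - X p) * g = f - rename (Equiv.swap i p) f) : divDiff i p f = g :=
  mul_left_cancel₀ (X_sub_X_ne_zero h) ((divDiff_spec i p f).trans hg.symm)

theorem divDiff_comm {i p : Fin N} (h : i ≠ p) (f : MvPolynomial (Fin N) K) :
    divDiff i p f = -divDiff p i f := by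
  refine divDiff_unique h ?_
  have := divDiff_spec p i f
  rw [Equiv.swap_comm] at this
  rw [← this]; ring

theorem divDiff_add {i p : Fin N} (h : i ≠ p) (f g : MvPolynomial (Fin N) K) :
    divDiff i p (f + g) = divDiff i p f + divDiff i p g := by
  refine divDiff_unique h ?_
  rw [mul_add, divDiff_spec, divDiff_spec, map_add]; ring

theorem divDiff_smul {i p : Fin N} (h : i ≠ p) (c : K) (f : MvPolynomial (Fin N) K) :
    divDiff i p (c • f) = c • divDiff i p f := by
  refine divDiff_unique h ?_
  rw [mul_smul_comm, divDiff_spec, map_smul, smul_sub]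

theorem act_swap_of_eq {η : Fin N →₀ ℕ} {i p : Fin N} (h : η i = η p) :
    act (Equiv.swap i p) η = η := by
  ext x
  rw [act_apply, Equiv.symm_swap]
  by_cases hxi : x = i
  · subst hxi; rw [Equiv.swap_apply_left, h]
  by_cases hxp : x = p
  · subst hxp; rw [Equiv.swap_apply_right, h]
  · rw [Equiv.swap_apply_of_ne_of_ne hxi hxp]

theorem rename_perm_monomial (w : Equiv.Perm (Fin N)) (η : Fin N →₀ ℕ) (c : K) :
    rename w (monomial η c) = monomial (act w η) c := by
  rw [rename_monomial, act, Finsupp.equivMapDomain_eq_mapDomain]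

theorem coeff_rename_perm (w : Equiv.Perm (Fin N)) (η : Fin N →₀ ℕ)
    (f : MvPolynomial (Fin N) K) : coeff (act w η) (rename w f) = coeff η f := by
  rw [act, Finsupp.equivMapDomain_eq_mapDomain, coeff_rename_mapDomain _ w.injective]

/-- The Cherednik operator as a linear map. -/
noncomputable def cherednikHom (α : K) (i : Fin N) : MvPolynomial (Fin N) K →ₗ[K] MvPolynomial (Fin N) K where
  toFun := cherednik α i
  map_add' f g := by
    have h1 : ∀ p ∈ Finset.univ.filter (fun p => p < i),
        X i * divDiff i p (f + g) = X i * divDiff i p f + X i * divDiff i p g := fun p hp => by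
      rw [divDiff_add (by simpa using hp : p < i).ne', mul_add]
    have h2 : ∀ p ∈ Finset.univ.filter (fun p => i < p),
        X p * divDiff i p (f + g) = X p * divDiff i p f + X p * divDiff i p g := fun p hp => by
      rw [divDiff_add (by simpa using hp : i < p).ne, mul_add]
    simp only [cherednik, Finset.sum_congr rfl h1, Finset.sum_congr rfl h2,
      Finset.sum_add_distrib, map_add]
    ring
  map_smul' c f := by
    have h1 : ∀ p ∈ Finset.univ.filter (fun p => p < i),
        X i * divDiff i p (c • f) = c • (X i * divDiff i p f) := fun p hp => by
      rw [divDiff_smul (by simpa using hp : p < i).ne', mul_smul_comm]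
    have h2 : ∀ p ∈ Finset.univ.filter (fun p => i < p),
        X p * divDiff i p (c • f) = c • (X p * divDiff i p f) := fun p hp => by
      rw [divDiff_smul (by simpa using hp : i < p).ne, mul_smul_comm]
    simp only [cherednik, Finset.sum_congr rfl h1, Finset.sum_congr rfl h2,
      ← Finset.smul_sum, (pderiv i).map_smul, mul_smul_comm, smul_sub, smul_add, RingHom.id_apply]

@[simp] theorem cherednikHom_apply (α : K) (i : Fin N) (f : MvPolynomial (Fin N) K) :
    cherednikHom α i f = cherednik α i f := rfl

/-- The polynomials all of whose monomials precede `z^η`. -/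
def lower (K : Type*) [Field K] (η : Fin N →₀ ℕ) : Submodule K (MvPolynomial (Fin N) K) where
  carrier := {f | ∀ ν, coeff ν f ≠ 0 → Precedes ν η}
  add_mem' {f g} hf hg ν hν := by
    by_cases h : coeff ν f = 0
    · exact hg ν fun h' => hν (by rw [coeff_add, h, h', add_zero])
    · exact hf ν h
  zero_mem' ν hν := absurd (coeff_zero ν) hν
  smul_mem' c f hf ν hν := hf ν fun h => hν (by rw [coeff_smul, h, smul_zero])

theorem monomial_mem_lower {ν η : Fin N →₀ ℕ} (h : Precedes ν η) (c : K) :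
    monomial ν c ∈ lower K η := by
  classical
  intro μ hμ
  rw [coeff_monomial] at hμ
  split_ifs at hμ with h'
  · exact h' ▸ h
  · exact absurd rfl hμ

/-- Write `z^η = z^μ z_i^{e+1}` with `μ_i = μ_p`. The transposition fixes `z^μ`, so the divided
difference is `z^μ` times a geometric sum in `z_i, z_p`. After multiplication by `z_i` its top term
is `z^η`; the others have `i`-exponent strictly between `η_p` and `η_i`. -/
theorem X_mul_divDiff_monomial_sub_mem {η : Fin N →₀ ℕ} {i p : Fin N} (h : η p < η i) :
    X i * divDiff i p (monomial η (1 : K)) - monomial η 1 ∈ lower K η := by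
  have hip : i ≠ p := by rintro rfl; exact h.false
  obtain ⟨e, he⟩ : ∃ e, η i = η p + e + 1 := ⟨η i - η p - 1, by omega⟩
  set μ : Fin N →₀ ℕ := η.update i (η p) with hμ
  have hμi : μ i = η p := by simp [hμ]
  have hμx : ∀ x, x ≠ i → μ x = η x := fun x hx => by simp [hμ, Finsupp.update_apply, hx]
  have hη : monomial η (1 : K) = monomial μ 1 * X i ^ (e + 1) := by
    rw [X_pow_eq_monomial, monomial_mul, one_mul]
    refine congrArg (fun μ => monomial μ (1 : K)) (Finsupp.ext fun x => ?_)
    by_cases hx : x = i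
    · subst hx; simp [hμi, he, add_assoc]
    · simp [hμx x hx, Ne.symm hx]
  have hs : rename (Equiv.swap i p) (monomial μ (1 : K)) = monomial μ 1 := by
    rw [rename_perm_monomial, act_swap_of_eq (by rw [hμi, hμx p hip.symm])]
  have hd : divDiff i p (monomial η (1 : K))
      = monomial μ 1 * ∑ k ∈ Finset.range (e + 1), X i ^ k * X p ^ (e + 1 - 1 - k) := by
    refine divDiff_unique hip ?_
    rw [mul_left_comm, mul_comm (X i - X p), geom_sum₂_mul, hη, map_mul, hs, map_pow, rename_X,
      Equiv.swap_apply_left, mul_sub]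
  rw [hd, Finset.sum_range_succ, mul_add, mul_add, hη]
  have hlast : X i * (monomial μ (1 : K) * (X i ^ e * X p ^ (e + 1 - 1 - e)))
      = monomial μ 1 * X i ^ (e + 1) := by
    rw [show e + 1 - 1 - e = 0 by omega]; ring
  rw [hlast, add_sub_cancel_right, Finset.mul_sum, Finset.mul_sum]
  refine Submodule.sum_mem _ fun k hk => ?_
  have hk : k < e := by simpa using hk
  have : X i * (monomial μ (1 : K) * (X i ^ k * X p ^ (e + 1 - 1 - k)))
      = monomial (μ + Finsupp.single i (k + 1) + Finsupp.single p (e - k)) 1 := by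
    rw [show e + 1 - 1 - k = e - k by omega, mul_left_comm, ← mul_assoc (X i), ← pow_succ',
      X_pow_eq_monomial, X_pow_eq_monomial, monomial_mul, monomial_mul, one_mul, one_mul,
      add_assoc]
  rw [this]
  refine monomial_mem_lower (precedes_of_between hip ?_ ?_ ?_ ?_) _
  · simp [hμi, hμx p hip.symm, hip, hip.symm]; omega
  · simp [hμi, hip.symm]
  · simp [hμi, hip.symm]; omega
  · intro x hxi hxp
    simp [hμx x hxi, Ne.symm hxi, Ne.symm hxp]

/-- Replacing the factor `z_i` by `z_p` subtracts `z^η - s_{ip} z^η`, so the top term becomes the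
transposed monomial. -/
theorem X_mul_divDiff_monomial_sub_mem' {η : Fin N →₀ ℕ} {i p : Fin N} (h : η p < η i) :
    X p * divDiff i p (monomial η (1 : K)) - monomial (act (Equiv.swap i p) η) 1 ∈ lower K η := by
  have h1 := X_mul_divDiff_monomial_sub_mem (K := K) h
  have h2 := divDiff_spec i p (monomial η (1 : K))
  rw [rename_perm_monomial] at h2
  convert h1 using 1
  linear_combination -h2

theorem divDiff_monomial_eq_zero {η : Fin N →₀ ℕ} {i p : Fin N} (hip : i ≠ p) (h : η p = η i) :
    divDiff i p (monomial η (1 : K)) = 0 := by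
  refine divDiff_unique hip ?_
  rw [rename_perm_monomial, mul_zero, eq_comm, sub_eq_zero]
  rw [act_swap_of_eq h.symm]

/-- The transposed monomial arises when `η_i < η_p`; it is itself lower, because with `p < i` the
larger entry moves to the right. -/
theorem lower_left_term (η : Fin N →₀ ℕ) {i p : Fin N} (hip : p < i) :
    X i * divDiff i p (monomial η (1 : K)) - (if η p < η i then (1 : K) else 0) • monomial η 1
      ∈ lower K η := by
  rcases lt_trichotomy (η p) (η i) with h | h | h
  · rw [if_pos h, one_smul]; exact X_mul_divDiff_monomial_sub_mem h
  · rw [if_neg h.not_lt, divDiff_monomial_eq_zero hip.ne' h]; simp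
  · rw [if_neg h.not_gt, zero_smul, sub_zero, divDiff_comm hip.ne', mul_neg]
    have h1 := (lower K η).add_mem (X_mul_divDiff_monomial_sub_mem' (K := K) h)
      (monomial_mem_lower (precedes_act_swap hip h) (1 : K))
    rw [sub_add_cancel] at h1
    exact (lower K η).neg_mem h1

theorem lower_right_term (η : Fin N →₀ ℕ) {i p : Fin N} (hip : i < p) :
    X p * divDiff i p (monomial η (1 : K)) + (if η i < η p then (1 : K) else 0) • monomial η 1
      ∈ lower K η := by
  rcases lt_trichotomy (η p) (η i) with h | h | h
  · rw [if_neg h.not_gt, zero_smul, add_zero]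
    have h1 := (lower K η).add_mem (X_mul_divDiff_monomial_sub_mem' (K := K) h)
      (monomial_mem_lower (precedes_act_swap hip h) (1 : K))
    rwa [sub_add_cancel] at h1
  · rw [if_neg h.symm.not_lt, divDiff_monomial_eq_zero hip.ne h]; simp
  · rw [if_pos h, one_smul, divDiff_comm hip.ne]
    have h1 := (lower K η).neg_mem (X_mul_divDiff_monomial_sub_mem (K := K) h)
    convert h1 using 1
    ring

/-- The Cherednik operators are triangular with diagonal entries the eigenvalues. -/
theorem cherednik_monomial_sub_mem (α : K) (i : Fin N) (η : Fin N →₀ ℕ) :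
    cherednik α i (monomial η 1) - eigenvalue α η i • monomial η 1 ∈ lower K η := by
  have h1 := (lower K η).sum_mem (t := Finset.univ.filter (fun p => p < i))
    fun p hp => lower_left_term (K := K) η (by simpa using hp : p < i)
  have h2 := (lower K η).sum_mem (t := Finset.univ.filter (fun p => i < p))
    fun p hp => lower_right_term (K := K) η (by simpa using hp : i < p)
  have h3 := (lower K η).add_mem h1 h2
  convert h3 using 1
  have hpd : X i * pderiv i (monomial η (1 : K)) = (η i : K) • monomial η 1 := by
    rw [X_mul_pderiv_monomial]; simp [← Nat.cast_smul_eq_nsmul K]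
  -- Subtracting `i`, the number of all `p < i`, turns the count of `p < i` with `η_p < η_i` into
  -- minus the count with `η_p ≥ η_i`.
  have heig : eigenvalue α η i = α * η i
      + (∑ p ∈ Finset.univ.filter (fun p => p < i), if η p < η i then (1 : K) else 0)
      - (∑ p ∈ Finset.univ.filter (fun p => i < p), if η i < η p then (1 : K) else 0)
      - (i.val : K) := by
    have hc : (i.val : K) = ∑ p ∈ Finset.univ.filter (fun p => p < i), (1 : K) := by
      rw [Finset.sum_const, nsmul_one, ← Fin.card_Iio i]
      congr 2
      ext; simp
    have hc' : ((Finset.univ.filter (fun k => k < i ∧ η i ≤ η k)).card : K)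
        = ∑ p ∈ Finset.univ.filter (fun p => p < i), if η p < η i then (0 : K) else 1 := by
      rw [Finset.card_filter, Finset.sum_filter]
      push_cast
      refine Finset.sum_congr rfl fun p _ => ?_
      by_cases h : p < i <;> by_cases h' : η p < η i <;> simp [h, h', not_lt.mp, not_le.mpr]
    have hc'' : ((Finset.univ.filter (fun k => i < k ∧ η i < η k)).card : K)
        = ∑ p ∈ Finset.univ.filter (fun p => i < p), if η i < η p then (1 : K) else 0 := by
      rw [Finset.card_filter, Finset.sum_filter]
      push_cast
      refine Finset.sum_congr rfl fun p _ => ?_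
      by_cases h : i < p <;> simp [h]
    have : ∑ p ∈ Finset.univ.filter (fun p => p < i), (1 : K)
        = (∑ p ∈ Finset.univ.filter (fun p => p < i), if η p < η i then (1 : K) else 0)
        + ∑ p ∈ Finset.univ.filter (fun p => p < i), if η p < η i then (0 : K) else 1 := by
      rw [← Finset.sum_add_distrib]
      refine Finset.sum_congr rfl fun p _ => ?_
      split_ifs <;> simp
    rw [eigenvalue, hc', hc'', hc, this]
    ring
  rw [heig, Finset.sum_sub_distrib, Finset.sum_add_distrib, ← Finset.sum_smul, ← Finset.sum_smul,
    cherednik, mul_assoc, hpd]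
  simp only [smul_eq_C_mul, map_mul, map_add, map_sub]
  ring

/-! ### Leading monomials of joint eigenvectors -/

theorem cherednik_eq_sum (α : K) (i : Fin N) (f : MvPolynomial (Fin N) K) :
    cherednik α i f = ∑ ν ∈ f.support, coeff ν f • cherednik α i (monomial ν 1) := by
  conv_lhs => rw [← cherednikHom_apply, f.as_sum, map_sum]
  refine Finset.sum_congr rfl fun ν _ => ?_
  rw [← cherednikHom_apply, ← map_smul, smul_monomial, smul_eq_mul, mul_one]

/-- By triangularity another monomial `z^ν` of `f` could contribute at `μ` only if `μ ≺ ν`, so just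
the diagonal entry is left. -/
theorem coeff_cherednik_of_maximal (α : K) (i : Fin N) {f : MvPolynomial (Fin N) K}
    {μ : Fin N →₀ ℕ} (hmax : ∀ ν, coeff ν f ≠ 0 → ¬ Precedes μ ν) :
    coeff μ (cherednik α i f) = eigenvalue α μ i * coeff μ f := by
  classical
  have key : ∀ ν ∈ f.support, coeff μ (coeff ν f • cherednik α i (monomial ν 1))
      = if ν = μ then eigenvalue α μ i * coeff μ f else 0 := by
    intro ν hν
    have h : coeff μ (cherednik α i (monomial ν 1) - eigenvalue α ν i • monomial ν 1) = 0 := by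
      by_contra h
      exact hmax ν (mem_support_iff.mp hν) (cherednik_monomial_sub_mem α i ν μ h)
    rw [coeff_sub, sub_eq_zero, coeff_smul, coeff_monomial] at h
    rw [coeff_smul, h]
    split_ifs with h'
    · subst h'; simp [mul_comm]
    · simp
  rw [cherednik_eq_sum, coeff_sum, Finset.sum_congr rfl key, Finset.sum_ite_eq']
  split_ifs with h
  · rfl
  · rw [notMem_support_iff.mp h, mul_zero]

/-- Every monomial of a joint eigenvector is bounded by one whose composition has the same
eigenvalues. -/
theorem exists_leading (α : K) {x : Fin N → K} {f : MvPolynomial (Fin N) K}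
    (hf : ∀ i, cherednik α i f = C (x i) * f) {ν : Fin N →₀ ℕ} (hν : coeff ν f ≠ 0) :
    ∃ μ, coeff μ f ≠ 0 ∧ (∀ i, eigenvalue α μ i = x i) ∧ (ν = μ ∨ Precedes ν μ) := by
  classical
  -- The order is reversed so that induction climbs to larger monomials; it terminates because the
  -- support is finite.
  let r : (Fin N →₀ ℕ) → (Fin N →₀ ℕ) → Prop := fun a b => Precedes b a
  have : IsStrictOrder (Fin N →₀ ℕ) r :=
    { irrefl := fun _ => Precedes.irrefl, trans := fun _ _ _ h h' => h'.trans h }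
  have hwf : (f.support : Set (Fin N →₀ ℕ)).WellFoundedOn r := Finset.wellFoundedOn _
  refine hwf.induction (P := fun ν => ∃ μ, coeff μ f ≠ 0 ∧ (∀ i, eigenvalue α μ i = x i) ∧
    (ν = μ ∨ Precedes ν μ)) (by simpa using hν) fun ν hν ih => ?_
  by_cases h : ∃ ν', coeff ν' f ≠ 0 ∧ Precedes ν ν'
  · obtain ⟨ν', hν', hlt⟩ := h
    obtain ⟨μ, h1, h2, h3⟩ := ih ν' (by simpa using hν') hlt
    refine ⟨μ, h1, h2, Or.inr ?_⟩
    rcases h3 with rfl | h3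
    · exact hlt
    · exact hlt.trans h3
  · push Not at h
    have hν' : coeff ν f ≠ 0 := by simpa using hν
    refine ⟨ν, hν', fun i => ?_, Or.inl rfl⟩
    have := coeff_cherednik_of_maximal α i h
    rw [hf, coeff_C_mul] at this
    exact (mul_right_cancel₀ hν' this).symm

/-- The bounding composition from `exists_leading` has the eigenvalues of `η`, so it is `η`. Thus
the triangular shape need not be tracked when eigenvectors are constructed. -/
theorem eq_or_precedes_of_eigenvector {α : K}
    (hα : ∀ a b : ℕ, 0 < a → (a : K) * α + (b : K) ≠ 0) {η : Fin N →₀ ℕ}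
    {f : MvPolynomial (Fin N) K} (hf : ∀ i, cherednik α i f = C (eigenvalue α η i) * f)
    {ν : Fin N →₀ ℕ} (hν : coeff ν f ≠ 0) : coeff η f ≠ 0 ∧ (ν = η ∨ Precedes ν η) := by
  obtain ⟨μ, h1, h2, h3⟩ := exists_leading α hf hν
  obtain rfl := eigenvalue_injective hα h2
  exact ⟨h1, h3⟩

theorem eq_zero_of_eigenvector {α : K}
    (hα : ∀ a b : ℕ, 0 < a → (a : K) * α + (b : K) ≠ 0) {η : Fin N →₀ ℕ}
    {f : MvPolynomial (Fin N) K} (hf : ∀ i, cherednik α i f = C (eigenvalue α η i) * f)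
    (h0 : coeff η f = 0) : f = 0 := by
  by_contra h
  obtain ⟨ν, hν⟩ := ne_zero_iff.mp h
  exact (eq_or_precedes_of_eigenvector hα hf hν).1 h0

end PrescribedJack

namespace PrescribedJack

variable {K : Type*} [Field K]

/-! ### Commutation relations -/

section
variable {N : ℕ}

/-- The summand of the Cherednik operator that exchanges `z_i` and `z_p`. -/
noncomputable def exchangeTerm (i p : Fin N) (f : MvPolynomial (Fin N) K) :
    MvPolynomial (Fin N) K :=
  if p < i then X i * divDiff i p f else if i < p then X p * divDiff i p f else 0

theorem exchangeTerm_of_lt {i p : Fin N} (h : p < i) (f : MvPolynomial (Fin N) K) :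
    exchangeTerm i p f = X i * divDiff i p f := if_pos h

theorem exchangeTerm_of_gt {i p : Fin N} (h : i < p) (f : MvPolynomial (Fin N) K) :
    exchangeTerm i p f = X p * divDiff i p f := by
  rw [exchangeTerm, if_neg h.not_gt, if_pos h]

theorem exchangeTerm_self (i : Fin N) (f : MvPolynomial (Fin N) K) :
    exchangeTerm i i f = 0 := by
  simp [exchangeTerm]

theorem cherednik_eq (α : K) (i : Fin N) (f : MvPolynomial (Fin N) K) :
    cherednik α i f = C α * X i * pderiv i f + ∑ p, exchangeTerm i p f - C (i.val : K) * f := by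
  have : ∑ p, exchangeTerm i p f
      = ∑ p ∈ Finset.univ.filter (fun p => p < i), X i * divDiff i p f
        + ∑ p ∈ Finset.univ.filter (fun p => i < p), X p * divDiff i p f := by
    rw [Finset.sum_filter, Finset.sum_filter, ← Finset.sum_add_distrib]
    refine Finset.sum_congr rfl fun p _ => ?_
    rcases lt_trichotomy p i with h | rfl | h
    · rw [exchangeTerm_of_lt h, if_pos h, if_neg h.not_gt, add_zero]
    · simp [exchangeTerm_self]
    · rw [exchangeTerm_of_gt h, if_pos h, if_neg h.not_gt, zero_add]
  rw [this, cherednik, add_assoc]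

theorem rename_divDiff (σ : Equiv.Perm (Fin N)) {i p : Fin N} (h : i ≠ p)
    (f : MvPolynomial (Fin N) K) :
    rename σ (divDiff i p f) = divDiff (σ i) (σ p) (rename σ f) := by
  refine (divDiff_unique (σ.injective.ne h) ?_).symm
  have h1 := congrArg (rename σ) (divDiff_spec i p f)
  have h2 : (Equiv.swap (σ i) (σ p) ∘ σ : Fin N → Fin N) = σ ∘ Equiv.swap i p := by
    funext x
    simp [Equiv.swap_apply_apply]
  rw [map_mul, map_sub, map_sub, rename_X, rename_X, rename_rename, ← h2] at h1
  rw [h1, rename_rename]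

theorem rename_exchangeTerm (σ : Equiv.Perm (Fin N)) {i p : Fin N}
    (h1 : σ p < σ i ↔ p < i) (h2 : σ i < σ p ↔ i < p) (f : MvPolynomial (Fin N) K) :
    rename σ (exchangeTerm i p f) = exchangeTerm (σ i) (σ p) (rename σ f) := by
  rcases lt_trichotomy p i with h | rfl | h
  · rw [exchangeTerm_of_lt h, exchangeTerm_of_lt (h1.mpr h), map_mul, rename_X,
      rename_divDiff σ h.ne']
  · simp [exchangeTerm_self]
  · rw [exchangeTerm_of_gt h, exchangeTerm_of_gt (h2.mpr h), map_mul, rename_X,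
      rename_divDiff σ h.ne]

/-- The defect of equivariance: the derivative part is equivariant, so only the exchange terms and
the constant `-i` are left. By `rename_exchangeTerm` the terms cancel for pairs whose order `σ`
preserves. -/
theorem cherednik_rename (α : K) (σ : Equiv.Perm (Fin N)) (i : Fin N)
    (f : MvPolynomial (Fin N) K) :
    cherednik α (σ i) (rename σ f) = rename σ (cherednik α i f)
      + ∑ p, (exchangeTerm (σ i) (σ p) (rename σ f) - rename σ (exchangeTerm i p f))
      - (C ((σ i).val : K) - C (i.val : K)) * rename σ f := by
  rw [cherednik_eq, cherednik_eq, ← Equiv.sum_comp σ, Finset.sum_sub_distrib]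
  simp only [map_sub, map_add, map_mul, rename_X, map_sum, rename_C, pderiv_rename σ.injective]
  ring

end

section
variable {n : ℕ}

/-! ### Adjacent transpositions and intertwiners -/

theorem simple_castSucc (a : Fin n) : simple a a.castSucc = a.succ := Equiv.swap_apply_left _ _

theorem simple_succ (a : Fin n) : simple a a.succ = a.castSucc := Equiv.swap_apply_right _ _

theorem simple_of_ne {a : Fin n} {x : Fin (n + 1)} (h1 : x ≠ a.castSucc) (h2 : x ≠ a.succ) :
    simple a x = x := Equiv.swap_apply_of_ne_of_ne h1 h2

theorem simple_symm (a : Fin n) : (simple a).symm = simple a := Equiv.symm_swap _ _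

theorem simple_mul_self (a : Fin n) : simple a * simple a = 1 := Equiv.swap_mul_self _ _

theorem simple_simple (a : Fin n) (x : Fin (n + 1)) : simple a (simple a x) = x := by
  rw [← Equiv.Perm.mul_apply, simple_mul_self, Equiv.Perm.one_apply]

theorem simple_val (a : Fin n) (x : Fin (n + 1)) :
    (simple a x).val = if x.val = a.val then a.val + 1 else if x.val = a.val + 1 then a.val
      else x.val := by
  by_cases h1 : x = a.castSucc
  · subst h1; simp [simple_castSucc]
  · by_cases h2 : x = a.succ
    · subst h2; simp [simple_succ]
    · rw [simple_of_ne h1 h2, if_neg, if_neg]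
      · exact fun h => h2 (Fin.ext (by simpa using h))
      · exact fun h => h1 (Fin.ext (by simpa using h))

theorem simple_lt_simple_iff {a : Fin n} {x y : Fin (n + 1)}
    (h1 : ¬ (x = a.castSucc ∧ y = a.succ)) (h2 : ¬ (x = a.succ ∧ y = a.castSucc)) :
    simple a x < simple a y ↔ x < y := by
  rw [Fin.lt_def, Fin.lt_def, simple_val, simple_val]
  simp only [Fin.ext_iff, Fin.val_castSucc, Fin.val_succ] at h1 h2
  split_ifs <;> omega

theorem cherednik_rename_simple_of_ne (α : K) {a : Fin n} {i : Fin (n + 1)}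
    (h1 : i ≠ a.castSucc) (h2 : i ≠ a.succ) (f : MvPolynomial (Fin (n + 1)) K) :
    cherednik α i (rename (simple a) f) = rename (simple a) (cherednik α i f) := by
  have h := cherednik_rename α (simple a) i f
  rw [Finset.sum_eq_zero, simple_of_ne h1 h2] at h
  · rw [h]; ring
  · intro p _
    rw [rename_exchangeTerm, sub_self]
    · exact simple_lt_simple_iff (fun h => h2 h.2) (fun h => h1 h.2)
    · exact simple_lt_simple_iff (fun h => h1 h.1) (fun h => h2 h.1)

theorem rename_simple_rename_simple (a : Fin n) (f : MvPolynomial (Fin (n + 1)) K) :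
    rename (simple a) (rename (simple a) f) = f := by
  rw [rename_rename]
  have : (simple a ∘ simple a : Fin (n + 1) → Fin (n + 1)) = id := funext (simple_simple a)
  rw [this, rename_id_apply]

/-- The only pair whose order changes is `(a, a+1)`. Its two terms differ by `z_{a+1} - z_a` times a
divided difference, which is `s_a f - f`; the shift of the constant cancels `s_a f`. -/
theorem cherednik_succ_rename_simple (α : K) (a : Fin n) (f : MvPolynomial (Fin (n + 1)) K) :
    cherednik α a.succ (rename (simple a) f)
      = rename (simple a) (cherednik α a.castSucc f) - f := by
  have h := cherednik_rename α (simple a) a.castSucc f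
  have hlt : a.castSucc < a.succ := Fin.castSucc_lt_succ
  rw [Finset.sum_eq_single a.succ, simple_castSucc, simple_succ, exchangeTerm_of_lt hlt,
    exchangeTerm_of_gt hlt, map_mul, rename_X, simple_succ, rename_divDiff _ hlt.ne,
    simple_castSucc, simple_succ, ← sub_mul, divDiff_spec, Equiv.swap_comm] at h
  · have h' : rename (Equiv.swap a.castSucc a.succ) (rename (simple a) f) = f :=
      rename_simple_rename_simple a f
    rw [h, h', Fin.val_succ, Fin.val_castSucc]
    simp only [Nat.cast_add, Nat.cast_one, C_add, C_1]
    ring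
  · intro p _ hp
    rw [rename_exchangeTerm, sub_self]
    · exact simple_lt_simple_iff (fun h => hlt.ne h.2) (fun h => hp h.1)
    · exact simple_lt_simple_iff (fun h => hp h.2) (fun h => hlt.ne h.1)
  · simp

theorem cherednik_castSucc_rename_simple (α : K) (a : Fin n)
    (f : MvPolynomial (Fin (n + 1)) K) :
    cherednik α a.castSucc (rename (simple a) f)
      = rename (simple a) (cherednik α a.succ f) + f := by
  have h := cherednik_succ_rename_simple α a (rename (simple a) f)
  rw [rename_simple_rename_simple] at h
  rw [h, map_sub, rename_simple_rename_simple, rename_simple_rename_simple, sub_add_cancel]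

theorem act_simple_castSucc (a : Fin n) (η : Fin (n + 1) →₀ ℕ) :
    act (simple a) η a.castSucc = η a.succ := by
  rw [act_apply, simple_symm, simple_castSucc]

theorem act_simple_succ (a : Fin n) (η : Fin (n + 1) →₀ ℕ) :
    act (simple a) η a.succ = η a.castSucc := by
  rw [act_apply, simple_symm, simple_succ]

theorem act_simple_simple (a : Fin n) (η : Fin (n + 1) →₀ ℕ) (x : Fin (n + 1)) :
    act (simple a) η (simple a x) = η x := by
  rw [act_apply, Equiv.symm_apply_apply]

theorem act_simple_act_simple (a : Fin n) (η : Fin (n + 1) →₀ ℕ) :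
    act (simple a) (act (simple a) η) = η := by
  rw [← act_mul, simple_mul_self, act_one]

/-- Positions `a` and `a+1` are compared by their distinct entries, not by place; every other pair
keeps its relative position. -/
theorem rank_act_simple {a : Fin n} {η : Fin (n + 1) →₀ ℕ} (h : η a.castSucc ≠ η a.succ)
    (i : Fin (n + 1)) : rank (act (simple a) η) (simple a i) = rank η i := by
  unfold rank
  simp only [Finset.card_filter]
  rw [← Equiv.sum_comp (simple a)]
  refine Finset.sum_congr rfl fun k _ => ?_
  have : Before (act (simple a) η) (simple a k) (simple a i) ↔ Before η k i := by
    simp only [Before, act_simple_simple]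
    by_cases h1 : k = a.castSucc ∧ i = a.succ
    · obtain ⟨rfl, rfl⟩ := h1; simp [h]
    · by_cases h2 : k = a.succ ∧ i = a.castSucc
      · obtain ⟨rfl, rfl⟩ := h2; simp [h.symm]
      · rw [simple_lt_simple_iff h1 h2]
  simp only [this]

theorem eigenvalue_act_simple (α : K) {a : Fin n} {η : Fin (n + 1) →₀ ℕ}
    (h : η a.castSucc ≠ η a.succ) (i : Fin (n + 1)) :
    eigenvalue α (act (simple a) η) (simple a i) = eigenvalue α η i := by
  rw [eigenvalue_eq, eigenvalue_eq, rank_act_simple h, act_simple_simple]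

/-- `s_a f + (x_{a+1} - x_a)⁻¹ f` exchanges the joint eigenvalues of `f` at `a` and `a + 1`. -/
theorem cherednik_intertwine (α : K) {a : Fin n} {x : Fin (n + 1) → K}
    (hx : x a.succ - x a.castSucc ≠ 0) {f : MvPolynomial (Fin (n + 1)) K}
    (hf : ∀ i, cherednik α i f = C (x i) * f) (i : Fin (n + 1)) :
    cherednik α i (rename (simple a) f + C (x a.succ - x a.castSucc)⁻¹ * f)
      = C (x (simple a i)) * (rename (simple a) f + C (x a.succ - x a.castSucc)⁻¹ * f) := by
  have hC : (C (x a.succ) - C (x a.castSucc) : MvPolynomial (Fin (n + 1)) K)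
      * C (x a.succ - x a.castSucc)⁻¹ = 1 := by
    rw [← C_sub, ← C_mul, mul_inv_cancel₀ hx, C_1]
  rw [← smul_eq_C_mul, ← cherednikHom_apply, map_add, map_smul, cherednikHom_apply,
    cherednikHom_apply, hf, smul_eq_C_mul, smul_eq_C_mul]
  by_cases h1 : i = a.castSucc
  · subst h1
    rw [cherednik_castSucc_rename_simple, hf, map_mul, rename_C, simple_castSucc]
    linear_combination (-f) * hC
  by_cases h2 : i = a.succ
  · subst h2
    rw [cherednik_succ_rename_simple, hf, map_mul, rename_C, simple_succ]
    linear_combination f * hC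
  · rw [cherednik_rename_simple_of_ne α h1 h2, hf, map_mul, rename_C, simple_of_ne h1 h2]
    ring

/-! ### Raising the degree, and existence -/

/-- The cyclic permutation of the positions that moves the first one to the end. -/
def rot (n : ℕ) : Equiv.Perm (Fin (n + 1)) := (finRotate (n + 1)).symm

theorem rot_zero : rot n 0 = Fin.last n := by
  rw [rot, Equiv.symm_apply_eq, finRotate_last]

theorem rot_succ (j : Fin n) : rot n j.succ = j.castSucc := by
  rw [rot, Equiv.symm_apply_eq, finRotate_apply, Fin.coeSucc_eq_succ]

theorem divDiff_X_mul {N : ℕ} {i p l : Fin N} (hip : i ≠ p) (hi : l ≠ i) (hp : l ≠ p)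
    (g : MvPolynomial (Fin N) K) : divDiff i p (X l * g) = X l * divDiff i p g := by
  refine divDiff_unique hip ?_
  rw [map_mul, rename_X, Equiv.swap_apply_of_ne_of_ne hi hp, mul_left_comm, divDiff_spec, mul_sub]

theorem divDiff_X_left_mul {N : ℕ} {i p : Fin N} (hip : i ≠ p) (g : MvPolynomial (Fin N) K) :
    divDiff i p (X i * g) = X p * divDiff i p g + g := by
  refine divDiff_unique hip ?_
  rw [map_mul, rename_X, Equiv.swap_apply_left]
  linear_combination X p * divDiff_spec i p g

theorem divDiff_X_right_mul {N : ℕ} {i p : Fin N} (hip : i ≠ p) (g : MvPolynomial (Fin N) K) :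
    divDiff i p (X p * g) = X i * divDiff i p g - g := by
  refine divDiff_unique hip ?_
  rw [map_mul, rename_X, Equiv.swap_apply_right]
  linear_combination X i * divDiff_spec i p g

/-- The raising operator `f ↦ z_N f(z_N, z_1, …, z_{N-1})`. -/
noncomputable def raise (f : MvPolynomial (Fin (n + 1)) K) : MvPolynomial (Fin (n + 1)) K :=
  X (Fin.last n) * rename (rot n) f

/-- The position in front of `j+1` becomes the last one, behind `j`; passing `z_N` through that
divided difference produces `-raise f`, which compensates the change of the constant from `-(j+1)`
to `-j`. -/
theorem cherednik_castSucc_raise (α : K) (j : Fin n) (f : MvPolynomial (Fin (n + 1)) K) :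
    cherednik α j.castSucc (raise f) = raise (cherednik α j.succ f) := by
  have hjl : j.castSucc < Fin.last n := Fin.castSucc_lt_last j
  have h0 : exchangeTerm j.castSucc (Fin.last n) (raise f)
      = X (Fin.last n) * rename (rot n) (exchangeTerm j.succ 0 f) - raise f := by
    rw [exchangeTerm_of_gt hjl, exchangeTerm_of_lt (Fin.succ_pos j), raise,
      divDiff_X_right_mul hjl.ne, map_mul, rename_X, rename_divDiff _ (Fin.succ_pos j).ne',
      rot_zero, rot_succ]
    ring
  have h1 : ∀ p : Fin n, exchangeTerm j.castSucc p.castSucc (raise f)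
      = X (Fin.last n) * rename (rot n) (exchangeTerm j.succ p.succ f) := by
    intro p
    rw [rename_exchangeTerm, rot_succ, rot_succ, raise]
    · have hpl : p.castSucc < Fin.last n := Fin.castSucc_lt_last p
      rcases lt_trichotomy p.castSucc j.castSucc with h | h | h
      · rw [exchangeTerm_of_lt h, exchangeTerm_of_lt h, divDiff_X_mul h.ne' hjl.ne' hpl.ne']
        ring
      · rw [h, exchangeTerm_self, exchangeTerm_self, mul_zero]
      · rw [exchangeTerm_of_gt h, exchangeTerm_of_gt h, divDiff_X_mul h.ne hjl.ne' hpl.ne']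
        ring
    · rw [rot_succ, rot_succ]; simp
    · rw [rot_succ, rot_succ]; simp
  rw [cherednik_eq, cherednik_eq, Fin.sum_univ_castSucc, Fin.sum_univ_succ, h0,
    Finset.sum_congr rfl fun p _ => h1 p, ← Finset.mul_sum]
  have hpd : pderiv j.castSucc (raise f) = X (Fin.last n) * rename (rot n) (pderiv j.succ f) := by
    rw [raise, pderiv_mul, pderiv_X_of_ne hjl.ne', zero_mul, zero_add, ← rot_succ,
      pderiv_rename (rot n).injective]
  rw [hpd]
  simp only [raise, map_sub, map_add, map_mul, rename_X, rename_C, rot_succ, map_sum,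
    Fin.val_succ, Fin.val_castSucc, Nat.cast_add, Nat.cast_one, map_one]
  ring

/-- The derivative of the new factor `z_N` gives the shift by `α`. Each of the `n` exchange terms
gains `raise f`, which together cancel the constant `-n`. -/
theorem cherednik_last_raise (α : K) (f : MvPolynomial (Fin (n + 1)) K) :
    cherednik α (Fin.last n) (raise f) = raise (cherednik α 0 f + C α * f) := by
  have h1 : ∀ p : Fin n, exchangeTerm (Fin.last n) p.castSucc (raise f)
      = X (Fin.last n) * rename (rot n) (exchangeTerm 0 p.succ f) + raise f := by
    intro p
    have hpl : p.castSucc < Fin.last n := Fin.castSucc_lt_last p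
    rw [exchangeTerm_of_lt hpl, exchangeTerm_of_gt (Fin.succ_pos p), raise,
      divDiff_X_left_mul hpl.ne', map_mul, rename_X, rename_divDiff _ (Fin.succ_pos p).ne,
      rot_zero, rot_succ]
    ring
  rw [cherednik_eq, cherednik_eq, Fin.sum_univ_castSucc, Fin.sum_univ_succ,
    Finset.sum_congr rfl fun p _ => h1 p, exchangeTerm_self, exchangeTerm_self,
    Finset.sum_add_distrib, ← Finset.mul_sum, Finset.sum_const, Finset.card_univ, Fintype.card_fin]
  have hpd : pderiv (Fin.last n) (raise f)
      = rename (rot n) f + X (Fin.last n) * rename (rot n) (pderiv 0 f) := by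
    rw [raise, pderiv_mul, pderiv_X_self, one_mul, ← rot_zero, pderiv_rename (rot n).injective]
  rw [hpd]
  simp only [raise, map_sub, map_add, map_mul, rename_X, rename_C, rot_zero, map_sum,
    Fin.val_last, Fin.val_zero, Nat.cast_zero, map_zero, nsmul_eq_mul, map_natCast]
  ring

/-- The first position wins ties against equal entries. At the end it would lose them, but its entry
has grown by one, so the listing order is preserved. -/
theorem rank_rot {η μ : Fin (n + 1) →₀ ℕ} (h0 : μ (Fin.last n) = η 0 + 1)
    (h1 : ∀ j : Fin n, μ j.castSucc = η j.succ) (i : Fin (n + 1)) :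
    rank μ (rot n i) = rank η i := by
  unfold rank
  simp only [Finset.card_filter]
  rw [← Equiv.sum_comp (rot n)]
  refine Finset.sum_congr rfl fun k _ => ?_
  have : Before μ (rot n k) (rot n i) ↔ Before η k i := by
    unfold Before
    refine Fin.cases ?_ (fun i => ?_) i <;> refine Fin.cases ?_ (fun k => ?_) k
    · simp
    · simp only [rot_zero, rot_succ, h0, h1, Fin.castSucc_lt_last, Fin.not_lt_zero, and_true, and_false,
        or_false]
      omega
    · simp only [rot_zero, rot_succ, h0, h1, Fin.succ_pos, (Fin.castSucc_lt_last i).not_gt, and_true,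
        and_false, or_false]
      omega
    · simp [rot_succ, h1]
  simp only [this]

theorem cherednik_one (α : K) (i : Fin (n + 1)) :
    cherednik α i (1 : MvPolynomial (Fin (n + 1)) K) = C (eigenvalue α 0 i) * 1 := by
  have h1 : ∀ p : Fin (n + 1), exchangeTerm i p (1 : MvPolynomial (Fin (n + 1)) K) = 0 := by
    intro p
    rcases lt_trichotomy p i with h | rfl | h
    · rw [exchangeTerm_of_lt h, divDiff_unique h.ne' (g := 0) (by simp), mul_zero]
    · rw [exchangeTerm_self]
    · rw [exchangeTerm_of_gt h, divDiff_unique h.ne (g := 0) (by simp), mul_zero]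
  have h2 : rank (0 : Fin (n + 1) →₀ ℕ) i = i.val := by
    rw [← Fin.card_Iio i, rank]
    congr 1
    ext; simp [Before]
  rw [cherednik_eq, eigenvalue_eq, h2]
  simp [h1]

/-- The intertwined vector has the right eigenvalues. If it vanished, `f` would be an eigenvector of
the involution `s_a` with eigenvalue `-δ⁻¹`, forcing `δ² = 1`. -/
theorem exists_eigenvector_of_act {α : K}
    (hα : ∀ a b : ℕ, 0 < a → (a : K) * α + (b : K) ≠ 0) {η : Fin (n + 1) →₀ ℕ} {a : Fin n}
    (h : η a.castSucc < η a.succ)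
    (hη : ∃ f : MvPolynomial (Fin (n + 1)) K, f ≠ 0 ∧
      ∀ i, cherednik α i f = C (eigenvalue α η i) * f) :
    ∃ f : MvPolynomial (Fin (n + 1)) K, f ≠ 0 ∧
      ∀ i, cherednik α i f = C (eigenvalue α (act (simple a) η) i) * f := by
  obtain ⟨f, hf0, hf⟩ := hη
  have hδ := eigenvalue_sub_ne_zero hα h
  have hp := eigenvalue_sub_add_one_ne_zero hα h
  have hm := eigenvalue_sub_sub_one_ne_zero hα h
  refine ⟨rename (simple a) f
    + C (eigenvalue α η a.succ - eigenvalue α η a.castSucc)⁻¹ * f, fun h0 => ?_, fun i => ?_⟩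
  rotate_left
  · rw [cherednik_intertwine α hδ hf, ← eigenvalue_act_simple α h.ne (simple a i), simple_simple]
  set δ := eigenvalue α η a.succ - eigenvalue α η a.castSucc with hδdef
  have h1 : rename (simple a) f = -(C δ⁻¹ * f) := eq_neg_of_add_eq_zero_left h0
  have h2 := rename_simple_rename_simple a f
  rw [h1, map_neg, map_mul, rename_C, h1, mul_neg, neg_neg, ← mul_assoc, ← C_mul] at h2
  have h3 : C (δ⁻¹ * δ⁻¹ - 1) * f = 0 := by
    rw [C_sub, sub_mul, h2, C_1, one_mul, sub_self]
  rcases mul_eq_zero.mp h3 with h3 | h3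
  · rw [C_eq_zero] at h3
    have h4 : (δ + 1) * (δ - 1) = 0 := by
      field_simp at h3
      linear_combination -h3
    exact mul_ne_zero hp hm h4
  · exact hf0 h3

/-- Induction on the degree. A composition with positive last entry is raised from one of smaller
degree; otherwise a positive entry is carried to the last place by intertwiners, hence the reverse
induction on its position `k`. -/
theorem exists_eigenvector {α : K}
    (hα : ∀ a b : ℕ, 0 < a → (a : K) * α + (b : K) ≠ 0) (η : Fin (n + 1) →₀ ℕ) :
    ∃ f : MvPolynomial (Fin (n + 1)) K, f ≠ 0 ∧
      ∀ i, cherednik α i f = C (eigenvalue α η i) * f := by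
  obtain ⟨m, hm⟩ : ∃ m, ∑ i, η i = m := ⟨_, rfl⟩
  induction m generalizing η with
  | zero =>
    have : η = 0 := by
      ext i
      simpa using (Finset.sum_eq_zero_iff.mp hm) i (Finset.mem_univ i)
    subst this
    exact ⟨1, one_ne_zero, cherednik_one α⟩
  | succ m ih =>
    have key : ∀ (k : Fin (n + 1)) (η : Fin (n + 1) →₀ ℕ), ∑ i, η i = m + 1 → 0 < η k →
        ∃ f : MvPolynomial (Fin (n + 1)) K, f ≠ 0 ∧
          ∀ i, cherednik α i f = C (eigenvalue α η i) * f := by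
      intro k
      induction k using Fin.reverseInduction with
      | last =>
        intro η hη hk
        -- `ν` undoes the raising: the last entry, decreased by one, returns to the front.
        let ν : Fin (n + 1) →₀ ℕ :=
          Finsupp.equivFunOnFinite.symm (Fin.cons (η (Fin.last n) - 1) fun j => η j.castSucc)
        have h0 : η (Fin.last n) = ν 0 + 1 := by simp [ν]; omega
        have h1 : ∀ j : Fin n, η j.castSucc = ν j.succ := fun j => by simp [ν]
        obtain ⟨f, hf0, hf⟩ := ih ν (by
          rw [Fin.sum_univ_castSucc, Finset.sum_congr rfl fun j _ => h1 j, h0] at hη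
          rw [Fin.sum_univ_succ]; omega)
        refine ⟨raise f, mul_ne_zero (X_ne_zero _) ?_, fun i => ?_⟩
        · rwa [Ne, map_eq_zero_iff _ (rename_injective _ (rot n).injective)]
        · refine Fin.lastCases ?_ (fun j => ?_) i
          · rw [cherednik_last_raise, hf, eigenvalue_eq, eigenvalue_eq]
            have := rank_rot h0 h1 0
            rw [rot_zero] at this
            rw [this, h0]
            simp only [raise, map_add, map_mul, rename_C, Nat.cast_add, Nat.cast_one, map_sub,
              map_one]
            ring
          · rw [cherednik_castSucc_raise, hf, eigenvalue_eq, eigenvalue_eq]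
            have := rank_rot h0 h1 j.succ
            rw [rot_succ] at this
            rw [this, h1]
            simp only [raise, map_mul, rename_C]
            ring
      | cast j ihj =>
        intro η hη hk
        by_cases h : 0 < η j.succ
        · exact ihj η hη h
        · rw [← act_simple_act_simple j η]
          apply exists_eigenvector_of_act hα
          · rw [act_simple_castSucc, act_simple_succ]; omega
          · exact ihj _ (by rw [sum_act, hη]) (by rwa [act_simple_succ])
    obtain ⟨k, hk⟩ : ∃ k, 0 < η k := by
      by_contra! h
      rw [Finset.sum_eq_zero fun i _ => Nat.le_zero.mp (h i)] at hm
      omega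
    exact key k η hm hk

theorem existsUnique_isNonsymJack {α : K}
    (hα : ∀ a b : ℕ, 0 < a → (a : K) * α + (b : K) ≠ 0) (η : Fin (n + 1) →₀ ℕ) :
    ∃! P : MvPolynomial (Fin (n + 1)) K, IsNonsymJack α η P := by
  obtain ⟨f, hf0, hf⟩ := exists_eigenvector hα η
  have hc : coeff η f ≠ 0 := fun h => hf0 (eq_zero_of_eigenvector hα hf h)
  refine ⟨C (coeff η f)⁻¹ * f, ⟨⟨?_, fun ν hν h => ?_⟩, fun i => ?_⟩, fun P hP => ?_⟩
  · rw [coeff_C_mul, inv_mul_cancel₀ hc]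
  · rw [coeff_C_mul] at h
    exact (eq_or_precedes_of_eigenvector hα hf (right_ne_zero_of_mul h)).2.resolve_left hν
  · rw [← smul_eq_C_mul, ← cherednikHom_apply, map_smul, cherednikHom_apply, hf, smul_eq_C_mul,
      smul_eq_C_mul]
    ring
  · rw [← sub_eq_zero]
    refine eq_zero_of_eigenvector hα (η := η) (fun i => ?_) ?_
    · rw [← smul_eq_C_mul, ← cherednikHom_apply, map_sub, map_smul, cherednikHom_apply,
        cherednikHom_apply, hf, hP.2, smul_eq_C_mul, smul_eq_C_mul]
      ring
    · rw [coeff_sub, hP.1.1, coeff_C_mul, inv_mul_cancel₀ hc, sub_self]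

end

end PrescribedJack

namespace PrescribedJack

variable {K : Type*} [Field K] {n : ℕ}

/-! ### The simple transpositions on the nonsymmetric Jack polynomials -/

section
variable {α : K}

theorem nonsymJack_spec (hα : ∀ a b : ℕ, 0 < a → (a : K) * α + (b : K) ≠ 0)
    (η : Fin (n + 1) →₀ ℕ) : IsNonsymJack α η (nonsymJack α η) :=
  Classical.epsilon_spec (existsUnique_isNonsymJack hα η).exists

theorem eq_nonsymJack_of_eigenvector (hα : ∀ a b : ℕ, 0 < a → (a : K) * α + (b : K) ≠ 0)
    {η : Fin (n + 1) →₀ ℕ} {f : MvPolynomial (Fin (n + 1)) K}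
    (hf : ∀ i, cherednik α i f = C (eigenvalue α η i) * f) (h1 : coeff η f = 1) :
    f = nonsymJack α η := by
  have hE := nonsymJack_spec hα η
  rw [← sub_eq_zero]
  refine eq_zero_of_eigenvector hα (η := η) (fun i => ?_) (by rw [coeff_sub, h1, hE.1.1, sub_self])
  rw [← cherednikHom_apply, map_sub, cherednikHom_apply, cherednikHom_apply, hf, hE.2, mul_sub]

/-- The intertwined `E_η` has the eigenvalues of `s_aη`. It is already monic: `η ≺ s_aη`, so
`z^{s_aη}` is absent from `E_η` and comes only from `s_a z^η`. -/
theorem rename_simple_nonsymJack_of_lt (hα : ∀ a b : ℕ, 0 < a → (a : K) * α + (b : K) ≠ 0)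
    {a : Fin n} {η : Fin (n + 1) →₀ ℕ} (h : η a.castSucc < η a.succ) :
    rename (simple a) (nonsymJack α η) = nonsymJack α (act (simple a) η)
      - C (eigenvalue α η a.succ - eigenvalue α η a.castSucc)⁻¹ * nonsymJack α η := by
  have hE := nonsymJack_spec hα η
  rw [eq_sub_iff_add_eq]
  refine eq_nonsymJack_of_eigenvector hα (fun i => ?_) ?_
  · rw [cherednik_intertwine α (eigenvalue_sub_ne_zero hα h) hE.2,
      ← eigenvalue_act_simple α h.ne (simple a i), simple_simple]
  · have hne : act (simple a) η ≠ η := fun h' => by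
      have := act_simple_castSucc a η
      rw [h'] at this
      exact h.ne this
    have h0 : coeff (act (simple a) η) (nonsymJack α η) = 0 := by
      by_contra h0
      have h1 := hE.1.2 _ hne h0
      have h2 : Precedes (act (simple a) (act (simple a) η)) (act (simple a) η) :=
        precedes_act_swap (i := a.castSucc) (p := a.succ) Fin.castSucc_lt_succ
          (by rwa [act_simple_castSucc, act_simple_succ])
      rw [act_simple_act_simple] at h2
      exact Precedes.irrefl (h1.trans h2)
    rw [coeff_add, coeff_rename_perm, hE.1.1, coeff_C_mul, h0, mul_zero, add_zero]

/-- Here `δ = -1`, so the intertwined vector is `s_a E_η - E_η`. Were it nonzero, its leading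
composition would have eigenvalue difference `+1` from `a` to `a+1`, and no composition has that. -/
theorem rename_simple_nonsymJack_of_eq (hα : ∀ a b : ℕ, 0 < a → (a : K) * α + (b : K) ≠ 0)
    {a : Fin n} {η : Fin (n + 1) →₀ ℕ} (h : η a.castSucc = η a.succ) :
    rename (simple a) (nonsymJack α η) = nonsymJack α η := by
  have hE := nonsymJack_spec hα η
  have hlt : a.castSucc < a.succ := Fin.castSucc_lt_succ
  have hr : rank η a.succ = rank η a.castSucc + 1 := by
    have : Finset.univ.filter (fun k => Before η k a.succ)
        = insert a.castSucc (Finset.univ.filter (fun k => Before η k a.castSucc)) := by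
      ext k
      simp only [Finset.mem_filter, Finset.mem_univ, true_and, Finset.mem_insert, Before,
        Fin.ext_iff, Fin.lt_def, Fin.val_succ, Fin.val_castSucc, ← h]
      constructor
      · rintro (h' | ⟨h1, h2⟩)
        · exact Or.inr (Or.inl h')
        · rcases (Nat.lt_succ_iff_lt_or_eq).mp h2 with h2 | h2
          · exact Or.inr (Or.inr ⟨h1, h2⟩)
          · exact Or.inl h2
      · rintro (h' | h' | ⟨h1, h2⟩)
        · obtain rfl : k = a.castSucc := Fin.ext h'
          exact Or.inr ⟨rfl, by simp⟩
        · exact Or.inl h'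
        · exact Or.inr ⟨h1, by omega⟩
    unfold rank
    rw [this, Finset.card_insert_of_notMem (by simp)]
  have hδ : eigenvalue α η a.succ - eigenvalue α η a.castSucc = -1 := by
    rw [eigenvalue_eq, eigenvalue_eq, hr, h]; push_cast; ring
  have hint := cherednik_intertwine α (x := eigenvalue α η) (a := a) (by rw [hδ]; simp) hE.2
  rw [hδ] at hint
  rw [← sub_eq_zero]
  by_contra hne
  have hform : rename (simple a) (nonsymJack α η) + C (-1 : K)⁻¹ * nonsymJack α η
      = rename (simple a) (nonsymJack α η) - nonsymJack α η := by
    rw [inv_neg, inv_one, C_neg, C_1]; ring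
  rw [hform] at hint
  obtain ⟨ν, hν⟩ := ne_zero_iff.mp hne
  obtain ⟨μ, -, hμ, -⟩ := exists_leading α (x := fun i => eigenvalue α η (simple a i)) hint hν
  have h1 := hμ a.succ
  have h2 := hμ a.castSucc
  simp only [simple_succ, simple_castSucc] at h1 h2
  have hδμ : eigenvalue α μ a.succ - eigenvalue α μ a.castSucc = 1 := by
    rw [h1, h2]; linear_combination -hδ
  rcases lt_trichotomy (μ a.castSucc) (μ a.succ) with h' | h' | h'
  · exact eigenvalue_sub_sub_one_ne_zero hα h' (by rw [hδμ, sub_self])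
  · have hr' : rank μ a.castSucc < rank μ a.succ := rank_lt_rank (Or.inr ⟨h', hlt⟩)
    rw [eigenvalue_eq, eigenvalue_eq, h'] at hδμ
    have h0 : ((rank μ a.succ - rank μ a.castSucc : ℕ) : K) + 1 = 0 := by
      rw [Nat.cast_sub hr'.le]; linear_combination -hδμ
    -- With second argument `0`, `hα` says that a positive integer does not vanish in `K`.
    refine hα ((rank μ a.succ - rank μ a.castSucc) + 1) 0 (by omega) ?_
    rw [Nat.cast_add, Nat.cast_one, h0]; simp
  · refine eigenvalue_sub_add_one_ne_zero hα h' ?_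
    linear_combination -hδμ

theorem rename_simple_nonsymJack_mem_span (hα : ∀ a b : ℕ, 0 < a → (a : K) * α + (b : K) ≠ 0)
    (a : Fin n) (η : Fin (n + 1) →₀ ℕ) :
    ∃ c c' : K, rename (simple a) (nonsymJack α η)
      = C c * nonsymJack α η + C c' * nonsymJack α (act (simple a) η) := by
  rcases lt_trichotomy (η a.castSucc) (η a.succ) with h | h | h
  · refine ⟨-(eigenvalue α η a.succ - eigenvalue α η a.castSucc)⁻¹, 1, ?_⟩
    rw [rename_simple_nonsymJack_of_lt hα h, C_neg, C_1]; ring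
  · refine ⟨1, 0, ?_⟩
    rw [rename_simple_nonsymJack_of_eq hα h, C_0, C_1]; ring
  · set κ := act (simple a) η with hκ
    have hη : η = act (simple a) κ := by rw [hκ, act_simple_act_simple]
    have h' : κ a.castSucc < κ a.succ := by rwa [hκ, act_simple_castSucc, act_simple_succ]
    have h1 := rename_simple_nonsymJack_of_lt hα h'
    rw [← hη] at h1
    set δ := (eigenvalue α κ a.succ - eigenvalue α κ a.castSucc)⁻¹
    -- These coefficients come from applying `s_a` to the relation for `κ = s_aη` and eliminating
    -- `s_a E_κ`.
    refine ⟨δ, 1 - δ * δ, ?_⟩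
    have h2 := congrArg (rename (simple a)) h1
    rw [rename_simple_rename_simple, map_sub, map_mul, rename_C, h1] at h2
    rw [C_sub, C_mul, C_1]
    linear_combination -h2

end

/-! ### The diagram products under a simple transposition -/

theorem leg_eq_sum {N : ℕ} (η : Fin N →₀ ℕ) (i : Fin N) (j : ℕ) :
    leg η i j = ∑ k, ((if k < i ∧ j ≤ η k + 1 ∧ η k + 1 ≤ η i then 1 else 0)
      + (if i < k ∧ j ≤ η k ∧ η k ≤ η i then 1 else 0)) := by
  rw [leg, Finset.card_filter, Finset.card_filter, Finset.sum_add_distrib]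

/-- Only the pair `(a, a+1)` changes order. The shorter row, once above the longer one and then
below it, is counted by `j ≤ η_a + 1` and then by `j ≤ η_a`; these differ just at `j = η_a + 1`. -/
theorem leg_act_simple {a : Fin n} {η : Fin (n + 1) →₀ ℕ} (h : η a.castSucc < η a.succ)
    (i : Fin (n + 1)) (j : ℕ) :
    leg η i j = leg (act (simple a) η) (simple a i) j
      + if i = a.succ ∧ j = η a.castSucc + 1 then 1 else 0 := by
  rw [leg_eq_sum, leg_eq_sum, ← Equiv.sum_comp (simple a) (fun k =>
    (if k < simple a i ∧ j ≤ act (simple a) η k + 1 ∧ act (simple a) η k + 1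
      ≤ act (simple a) η (simple a i) then 1 else 0)
      + (if simple a i < k ∧ j ≤ act (simple a) η k ∧ act (simple a) η k
      ≤ act (simple a) η (simple a i) then 1 else 0))]
  have hsum : (if i = a.succ ∧ j = η a.castSucc + 1 then 1 else 0)
      = ∑ k, if k = a.castSucc then (if i = a.succ ∧ j = η a.castSucc + 1 then 1 else 0) else 0 := by
    simp
  rw [hsum, ← Finset.sum_add_distrib]
  refine Finset.sum_congr rfl fun k _ => ?_
  simp only [act_simple_simple]
  have hlt : a.castSucc < a.succ := Fin.castSucc_lt_succ
  by_cases h1 : k = a.castSucc ∧ i = a.succ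
  · obtain ⟨rfl, rfl⟩ := h1
    simp only [simple_castSucc, simple_succ, hlt, hlt.not_gt, true_and, false_and, if_true,
      if_false]
    split_ifs <;> omega
  · by_cases h2 : k = a.succ ∧ i = a.castSucc
    · obtain ⟨rfl, rfl⟩ := h2
      simp only [simple_castSucc, simple_succ, hlt, hlt.not_gt, true_and, false_and, if_false,
        hlt.ne']
      split_ifs <;> omega
    · simp only [simple_lt_simple_iff h1 h2, simple_lt_simple_iff (fun h => h2 h.symm)
        (fun h => h1 h.symm)]
      by_cases hk : k = a.castSucc
      · have hi : i ≠ a.succ := fun hi => h1 ⟨hk, hi⟩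
        simp [hi]
      · simp [hk]

/-- The leg length that changes under the transposition is the difference of the ranks. -/
theorem rank_eq_rank_add_leg {a : Fin n} {η : Fin (n + 1) →₀ ℕ} (h : η a.castSucc < η a.succ) :
    rank η a.castSucc = rank η a.succ + leg η a.succ (η a.castSucc + 1) := by
  have hlt : a.castSucc < a.succ := Fin.castSucc_lt_succ
  rw [leg_eq_sum]
  unfold rank
  rw [Finset.card_filter, Finset.card_filter, ← Finset.sum_add_distrib]
  have key : ∀ k : Fin (n + 1), k ≠ a.castSucc → k ≠ a.succ →
      (if Before η k a.castSucc then 1 else 0) = (if Before η k a.succ then 1 else 0)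
        + ((if k < a.succ ∧ η a.castSucc + 1 ≤ η k + 1 ∧ η k + 1 ≤ η a.succ then 1 else 0)
          + (if a.succ < k ∧ η a.castSucc + 1 ≤ η k ∧ η k ≤ η a.succ then 1 else 0)) := by
    intro k h1 h2
    simp only [Ne, Fin.ext_iff, Fin.val_castSucc, Fin.val_succ] at h1 h2
    simp only [Before, Fin.lt_def, Fin.val_castSucc, Fin.val_succ]
    split_ifs <;> omega
  rw [sum_eq_add_add_sum_erase hlt.ne (Finset.mem_univ _) (Finset.mem_univ _),
    sum_eq_add_add_sum_erase hlt.ne (Finset.mem_univ _) (Finset.mem_univ _),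
    Finset.sum_congr rfl fun k hk => key k (by simp_all) (by simp_all)]
  have h3 : ¬ η a.succ < η a.castSucc := by omega
  have h4 : ¬ η a.castSucc = η a.succ := by omega
  simp only [Before, hlt, h, lt_irrefl, h3, h4, Ne.symm h4, if_true, if_false, and_true, and_false,
    or_false, true_and, false_and, le_refl]
  split_ifs <;> omega

/-- This identifies `δ` with the `d'`-factor of the one box whose leg changes under `s_a`. -/
theorem eigenvalue_sub_eq_leg (α : K) {a : Fin n} {η : Fin (n + 1) →₀ ℕ}
    (h : η a.castSucc < η a.succ) :
    eigenvalue α η a.succ - eigenvalue α η a.castSucc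
      = α * (((η a.succ - (η a.castSucc + 1) : ℕ) : K) + 1)
        + (leg η a.succ (η a.castSucc + 1) : K) := by
  rw [eigenvalue_eq, eigenvalue_eq, rank_eq_rank_add_leg h, Nat.cast_sub (by omega)]
  push_cast
  ring

/-- Diagram products whose factors are the `α (a + 1) + l + t`. -/
theorem diagramProd_act_simple (α t : K) {a : Fin n} {η : Fin (n + 1) →₀ ℕ}
    (h : η a.castSucc < η a.succ) :
    (∏ i, ∏ j ∈ Finset.Icc 1 (η i), (α * (((η i - j : ℕ) : K) + 1) + (leg η i j : K) + t))
        * (eigenvalue α η a.succ - eigenvalue α η a.castSucc - 1 + t)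
      = (∏ i, ∏ j ∈ Finset.Icc 1 (act (simple a) η i),
          (α * (((act (simple a) η i - j : ℕ) : K) + 1) + (leg (act (simple a) η) i j : K) + t))
        * (eigenvalue α η a.succ - eigenvalue α η a.castSucc + t) := by
  rw [← Equiv.prod_comp (simple a) (fun i => ∏ j ∈ Finset.Icc 1 (act (simple a) η i),
          (α * (((act (simple a) η i - j : ℕ) : K) + 1) + (leg (act (simple a) η) i j : K) + t))]
  simp only [act_simple_simple]
  have hmem : η a.castSucc + 1 ∈ Finset.Icc 1 (η a.succ) := by
    rw [Finset.mem_Icc]; omega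
  -- Split off the box `(a+1, η_a + 1)`: its factor is `δ + t` for `η` and `δ - 1 + t` for `s_aη`,
  -- and all other factors agree.
  rw [← Finset.mul_prod_erase _ _ (Finset.mem_univ a.succ),
    ← Finset.mul_prod_erase _ _ (Finset.mem_univ a.succ),
    ← Finset.mul_prod_erase _ _ hmem, ← Finset.mul_prod_erase _ _ hmem]
  have e1 : ∏ i ∈ Finset.univ.erase a.succ, ∏ j ∈ Finset.Icc 1 (η i),
        (α * (((η i - j : ℕ) : K) + 1) + (leg η i j : K) + t)
      = ∏ i ∈ Finset.univ.erase a.succ, ∏ j ∈ Finset.Icc 1 (η i),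
        (α * (((η i - j : ℕ) : K) + 1) + (leg (act (simple a) η) (simple a i) j : K) + t) := by
    refine Finset.prod_congr rfl fun i hi => Finset.prod_congr rfl fun j _ => ?_
    rw [leg_act_simple h, if_neg (fun h' => (Finset.mem_erase.mp hi).1 h'.1), add_zero]
  have e2 : ∏ j ∈ (Finset.Icc 1 (η a.succ)).erase (η a.castSucc + 1),
        (α * (((η a.succ - j : ℕ) : K) + 1) + (leg η a.succ j : K) + t)
      = ∏ j ∈ (Finset.Icc 1 (η a.succ)).erase (η a.castSucc + 1),
        (α * (((η a.succ - j : ℕ) : K) + 1)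
          + (leg (act (simple a) η) (simple a a.succ) j : K) + t) := by
    refine Finset.prod_congr rfl fun j hj => ?_
    rw [leg_act_simple h, if_neg (fun h' => (Finset.mem_erase.mp hj).1 h'.2), add_zero]
  have e3 : (leg η a.succ (η a.castSucc + 1) : K)
      = (leg (act (simple a) η) (simple a a.succ) (η a.castSucc + 1) : K) + 1 := by
    rw [leg_act_simple h, if_pos ⟨rfl, rfl⟩]; push_cast; ring
  rw [e1, e2, eigenvalue_sub_eq_leg α h, e3]
  ring

theorem d_act_simple (α : K) {a : Fin n} {η : Fin (n + 1) →₀ ℕ} (h : η a.castSucc < η a.succ) :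
    d α η * (eigenvalue α η a.succ - eigenvalue α η a.castSucc)
      = d α (act (simple a) η) * (eigenvalue α η a.succ - eigenvalue α η a.castSucc + 1) := by
  have := diagramProd_act_simple α 1 h
  rwa [sub_add_cancel] at this

theorem d'_act_simple (α : K) {a : Fin n} {η : Fin (n + 1) →₀ ℕ} (h : η a.castSucc < η a.succ) :
    d' α η * (eigenvalue α η a.succ - eigenvalue α η a.castSucc - 1)
      = d' α (act (simple a) η) * (eigenvalue α η a.succ - eigenvalue α η a.castSucc) := by
  have := diagramProd_act_simple α 0 h
  simp only [add_zero] at this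
  exact this

theorem d_ne_zero {N : ℕ} {α : K} (hα : ∀ a b : ℕ, 0 < a → (a : K) * α + (b : K) ≠ 0)
    (η : Fin N →₀ ℕ) : d α η ≠ 0 := by
  refine Finset.prod_ne_zero_iff.mpr fun i _ => Finset.prod_ne_zero_iff.mpr fun j _ h => ?_
  refine hα (η i - j + 1) (leg η i j + 1) (by omega) ?_
  push_cast
  linear_combination h

theorem d'_ne_zero {N : ℕ} {α : K} (hα : ∀ a b : ℕ, 0 < a → (a : K) * α + (b : K) ≠ 0)
    (η : Fin N →₀ ℕ) : d' α η ≠ 0 := by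
  refine Finset.prod_ne_zero_iff.mpr fun i _ => Finset.prod_ne_zero_iff.mpr fun j _ h => ?_
  refine hα (η i - j + 1) (leg η i j) (by omega) ?_
  push_cast
  linear_combination h

end PrescribedJack

namespace PrescribedJack

variable {n : ℕ}

/-! ### Parabolic subgroups -/

theorem simple_mem_parabolic {A : Finset (Fin n)} {a : Fin n} (ha : a ∈ A) :
    simple a ∈ parabolic A :=
  Subgroup.subset_closure ⟨a, ha, rfl⟩

theorem simple_inv (a : Fin n) : (simple a)⁻¹ = simple a := simple_symm a

theorem parabolic_induction {A : Finset (Fin n)} {p : Equiv.Perm (Fin (n + 1)) → Prop}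
    (one : p 1) (mul : ∀ a ∈ A, ∀ w ∈ parabolic A, p w → p (simple a * w))
    {w : Equiv.Perm (Fin (n + 1))} (hw : w ∈ parabolic A) : p w := by
  induction hw using Subgroup.closure_induction_left with
  | one => exact one
  | mul_left x hx y hy ih =>
    obtain ⟨a, ha, rfl⟩ := hx
    exact mul a ha y hy ih
  | inv_mul_cancel x hx y hy ih =>
    obtain ⟨a, ha, rfl⟩ := hx
    rw [simple_inv]
    exact mul a ha y hy ih

theorem parabolic_mono {A B : Finset (Fin n)} (h : A ⊆ B) : parabolic A ≤ parabolic B :=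
  Subgroup.closure_mono (Set.image_mono (by exact_mod_cast h))

/-! ### Blocks and sorting inside a parabolic orbit -/

/-- Every step between the positions `x` and `y` is in `A`. -/
def SameBlock (A : Finset (Fin n)) (x y : Fin (n + 1)) : Prop :=
  ∀ k : Fin n, (x.val ≤ k.val ∧ k.val < y.val) ∨ (y.val ≤ k.val ∧ k.val < x.val) → k ∈ A

theorem SameBlock.trans {A : Finset (Fin n)} {x y z : Fin (n + 1)} (h : SameBlock A x y)
    (h' : SameBlock A y z) : SameBlock A x z := by
  intro k hk
  by_cases h1 : (x.val ≤ k.val ∧ k.val < y.val) ∨ (y.val ≤ k.val ∧ k.val < x.val)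
  · exact h k h1
  · exact h' k (by omega)

theorem sameBlock_simple {A : Finset (Fin n)} {a : Fin n} (ha : a ∈ A) (x : Fin (n + 1)) :
    SameBlock A x (simple a x) := by
  intro k hk
  rw [simple_val] at hk
  have : k = a := Fin.ext (by split_ifs at hk <;> omega)
  rwa [this]

theorem sameBlock_apply {A : Finset (Fin n)} {w : Equiv.Perm (Fin (n + 1))}
    (hw : w ∈ parabolic A) (x : Fin (n + 1)) : SameBlock A x (w x) := by
  refine parabolic_induction (p := fun w => SameBlock A x (w x)) ?_
    (fun a ha w _ ih => ih.trans (sameBlock_simple ha (w x))) hw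
  intro k hk
  simp at hk
  omega

theorem le_of_sorted {A : Finset (Fin n)} {f : Fin (n + 1) → ℤ}
    (hf : ∀ a ∈ A, f a.succ ≤ f a.castSucc) {x y : Fin (n + 1)} (hxy : x ≤ y)
    (h : ∀ k : Fin n, x.val ≤ k.val → k.val < y.val → k ∈ A) : f y ≤ f x := by
  induction y using Fin.induction with
  | zero => rw [Fin.le_zero_iff.mp hxy]
  | succ j ih =>
    rcases hxy.lt_or_eq with h' | rfl
    · have hx : x ≤ j.castSucc := Fin.le_castSucc_iff.mpr h'
      refine (hf j (h j hx (by simp))).trans (ih hx fun k h1 h2 => h k h1 ?_)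
      simp at h2 ⊢; omega
    · rfl

/-- Among the rearrangements by a parabolic subgroup the sorted one dominates. -/
theorem partialSum_comp_le {A : Finset (Fin n)} {f : Fin (n + 1) → ℤ}
    (hf : ∀ a ∈ A, f a.succ ≤ f a.castSucc) {w : Equiv.Perm (Fin (n + 1))}
    (hw : w ∈ parabolic A) (q : Fin (n + 1)) : partialSum (f ∘ w) q ≤ partialSum f q := by
  have h := sum_le_sum_of_threshold
    (S := (Finset.univ.filter (fun j => j ≤ q)).map w.toEmbedding)
    (T := Finset.univ.filter (fun j => j ≤ q)) f (f q) (by simp) (fun x hx hx' => ?_)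
    (fun x hx hx' => ?_)
  · rwa [Finset.sum_map] at h
  · simp only [Finset.mem_map, Finset.mem_filter, Finset.mem_univ, true_and, not_le] at hx hx'
    obtain ⟨y, hy, rfl⟩ := hx
    refine le_of_sorted hf hx'.le fun k h1 h2 => sameBlock_apply hw y k (Or.inl ⟨?_, h2⟩)
    exact le_trans (by exact_mod_cast hy) h1
  · simp only [Finset.mem_map, Finset.mem_filter, Finset.mem_univ, true_and] at hx hx'
    have hy : q < w.symm x := by
      by_contra! hy
      exact hx' ⟨w.symm x, hy, w.apply_symm_apply x⟩
    refine le_of_sorted hf hx fun k h1 h2 => ?_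
    have := sameBlock_apply hw (w.symm x) k
    rw [Equiv.apply_symm_apply] at this
    exact this (Or.inr ⟨h1, h2.trans (by exact_mod_cast hy)⟩)

/-- Two sorted rearrangements dominate each other. -/
theorem comp_eq_of_sorted {A : Finset (Fin n)} {f : Fin (n + 1) → ℤ}
    (hf : ∀ a ∈ A, f a.succ ≤ f a.castSucc) {w : Equiv.Perm (Fin (n + 1))}
    (hw : w ∈ parabolic A) (hfw : ∀ a ∈ A, (f ∘ w) a.succ ≤ (f ∘ w) a.castSucc) : f ∘ w = f := by
  refine partialSum_injective fun q => le_antisymm (partialSum_comp_le hf hw q) ?_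
  have := partialSum_comp_le hfw (inv_mem hw) q
  rwa [Function.comp_assoc, ← Equiv.Perm.coe_mul, mul_inv_cancel, Equiv.Perm.coe_one,
    Function.comp_id] at this

/-- Minimise `∑ x · f(w⁻¹ x)` over the finite group `W_A`: at an ascent, composing with `s_a` would
lower the sum. -/
theorem exists_sorted (A : Finset (Fin n)) (f : Fin (n + 1) → ℤ) :
    ∃ w ∈ parabolic A, ∀ a ∈ A, f (w.symm a.succ) ≤ f (w.symm a.castSucc) := by
  obtain ⟨w, hw, hmin⟩ := Set.exists_min_image (parabolic A : Set (Equiv.Perm (Fin (n + 1))))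
    (fun w => ∑ x : Fin (n + 1), (x.val : ℤ) * f (w.symm x)) (Set.toFinite _) ⟨1, one_mem _⟩
  refine ⟨w, hw, fun a ha => ?_⟩
  have h := hmin (simple a * w) (mul_mem (simple_mem_parabolic ha) hw)
  have e : ∑ x : Fin (n + 1), (x.val : ℤ) * f ((simple a * w).symm x)
      = ∑ x : Fin (n + 1), ((simple a x).val : ℤ) * f (w.symm x) := by
    rw [← Equiv.sum_comp (simple a)]
    refine Finset.sum_congr rfl fun x _ => ?_
    have : (simple a * w).symm (simple a x) = w.symm x := by
      rw [Equiv.symm_apply_eq, Equiv.Perm.mul_apply, Equiv.apply_symm_apply]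
    rw [this]
  have hlt : a.castSucc ≠ a.succ := (Fin.castSucc_lt_succ (i := a)).ne
  have hrest : ∑ x ∈ (Finset.univ.erase a.castSucc).erase a.succ,
        ((simple a x).val : ℤ) * f (w.symm x)
      = ∑ x ∈ (Finset.univ.erase a.castSucc).erase a.succ, (x.val : ℤ) * f (w.symm x) :=
    Finset.sum_congr rfl fun x hx => by rw [simple_of_ne (by simp_all) (by simp_all)]
  rw [e, sum_eq_add_add_sum_erase hlt (Finset.mem_univ _) (Finset.mem_univ _),
    sum_eq_add_add_sum_erase hlt (Finset.mem_univ _) (Finset.mem_univ _)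
      (fun x => ((simple a x).val : ℤ) * f (w.symm x)),
    hrest,
    simple_castSucc, simple_succ, Fin.val_succ, Fin.val_castSucc] at h
  push_cast at h
  linarith

theorem OrderedOnJ.orderedOnI {A : Finset (Fin n)} {η κ : Fin (n + 1) →₀ ℕ} {ε : SignType}
    (h : OrderedOnJ A η κ ε) : OrderedOnI A η κ ε := by
  cases ε with
  | zero => exact h
  | neg => exact fun a ha => (h a ha).le
  | pos => exact fun a ha => (h a ha).le

/-- `x` is one of the two positions exchanged by some `s_a`, `a ∈ A`. -/
def Touched (A : Finset (Fin n)) (x : Fin (n + 1)) : Prop :=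
  ∃ a ∈ A, x = a.castSucc ∨ x = a.succ

theorem apply_eq_of_not_touched {A : Finset (Fin n)} {w : Equiv.Perm (Fin (n + 1))}
    (hw : w ∈ parabolic A) {x : Fin (n + 1)} (hx : ¬ Touched A x) : w x = x := by
  refine parabolic_induction (p := fun w => w x = x) rfl (fun a ha w _ ih => ?_) hw
  rw [Equiv.Perm.mul_apply, ih]
  exact simple_of_ne (fun h => hx ⟨a, ha, Or.inl h⟩) (fun h => hx ⟨a, ha, Or.inr h⟩)

theorem act_apply_of_not_touched {A : Finset (Fin n)} {w : Equiv.Perm (Fin (n + 1))}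
    (hw : w ∈ parabolic A) (η : Fin (n + 1) →₀ ℕ) {x : Fin (n + 1)} (hx : ¬ Touched A x) :
    act w η x = η x := by
  rw [act_apply, ← Equiv.Perm.inv_def, apply_eq_of_not_touched (inv_mem hw) hx]

theorem act_eq_of_orderedOnI {A : Finset (Fin n)} {η : Fin (n + 1) →₀ ℕ} {ε : SignType}
    {v w : Equiv.Perm (Fin (n + 1))} (hv : v ∈ parabolic A) (hw : w ∈ parabolic A)
    (h1 : OrderedOnI A η (act v η) ε) (h2 : OrderedOnI A η (act w η) ε) :
    act v η = act w η := by
  -- The factor `c = ±1` reduces increasing order to decreasing order.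
  have key : ∀ c : ℤ, c ≠ 0 →
      (∀ a ∈ A, c * act v η a.succ ≤ c * act v η a.castSucc) →
      (∀ a ∈ A, c * act w η a.succ ≤ c * act w η a.castSucc) → act v η = act w η := by
    intro c hc h1 h2
    have e : (fun x => c * (act v η x : ℤ)) ∘ (v * w⁻¹ : Equiv.Perm (Fin (n + 1)))
        = fun x => c * (act w η x : ℤ) := by
      funext x
      simp [act_apply]
    have h := comp_eq_of_sorted (f := fun x => c * (act v η x : ℤ)) h1
      (mul_mem hv (inv_mem hw)) (by rw [e]; exact h2)
    rw [e] at h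
    ext x
    have := congrFun h x
    exact_mod_cast (mul_left_cancel₀ hc this).symm
  cases ε with
  | pos =>
    refine key 1 one_ne_zero (fun a ha => ?_) (fun a ha => ?_)
    · simpa using h1 a ha
    · simpa using h2 a ha
  | neg =>
    refine key (-1) (by norm_num) (fun a ha => ?_) (fun a ha => ?_)
    · simpa using h1 a ha
    · simpa using h2 a ha
  | zero =>
    have h : ∀ u ∈ parabolic A, OrderedOnI A η (act u η) .zero → act u η = η := by
      intro u hu h
      ext x
      by_cases hx : Touched A x
      · obtain ⟨a, ha, rfl | rfl⟩ := hx
        · exact (h a ha).1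
        · exact (h a ha).2
      · exact act_apply_of_not_touched hu η hx
    rw [h v hv h1, h w hw h2]

theorem exists_orderedOnI (A : Finset (Fin n)) (η : Fin (n + 1) →₀ ℕ) (ε : SignType) :
    ∃ w ∈ parabolic A, OrderedOnI A η (act w η) ε := by
  cases ε with
  | zero => exact ⟨1, one_mem _, fun a _ => ⟨by rw [act_one], by rw [act_one]⟩⟩
  | pos =>
    obtain ⟨w, hw, h⟩ := exists_sorted A (fun x => (η x : ℤ))
    exact ⟨w, hw, fun a ha => by exact_mod_cast h a ha⟩
  | neg =>
    obtain ⟨w, hw, h⟩ := exists_sorted A (fun x => -(η x : ℤ))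
    exact ⟨w, hw, fun a ha => by simpa using h a ha⟩

theorem DistinctOnBlocks.eq_of_sameBlock {A : Finset (Fin n)} {η : Fin (n + 1) →₀ ℕ}
    (hη : DistinctOnBlocks A η) {x y : Fin (n + 1)} (h : SameBlock A x y) (hxy : η x = η y) :
    x = y := by
  rcases lt_trichotomy x y with h' | h' | h'
  · exact absurd hxy (hη x y h' fun k h1 h2 => h k (Or.inl ⟨h1, h2⟩))
  · exact h'
  · exact absurd hxy.symm
      (hη y x h' fun k h1 h2 => h k (Or.inr ⟨h1, h2⟩))

theorem SameBlock.symm {A : Finset (Fin n)} {x y : Fin (n + 1)} (h : SameBlock A x y) :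
    SameBlock A y x := fun k hk => h k hk.symm

/-- A weak sorting is already strict: neighbouring entries come from two different positions of the
same block, where `η` is injective. -/
theorem exists_orderedOnJ {A : Finset (Fin n)} {η : Fin (n + 1) →₀ ℕ}
    (hη : DistinctOnBlocks A η) (ε : SignType) :
    ∃ w ∈ parabolic A, OrderedOnJ A η (act w η) ε := by
  obtain ⟨w, hw, h⟩ := exists_orderedOnI A η ε
  have hne : ∀ a ∈ A, act w η a.castSucc ≠ act w η a.succ := by
    intro a ha heq
    have hb : SameBlock A a.castSucc a.succ := by
      have := sameBlock_simple ha a.castSucc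
      rwa [simple_castSucc] at this
    have hb' := ((sameBlock_apply (inv_mem hw) a.castSucc).symm.trans hb).trans
      (sameBlock_apply (inv_mem hw) a.succ)
    have := w⁻¹.injective (hη.eq_of_sameBlock hb' heq)
    exact (Fin.castSucc_lt_succ (i := a)).ne this
  refine ⟨w, hw, ?_⟩
  cases ε with
  | zero => exact h
  | neg => exact fun a ha => lt_of_le_of_ne (h a ha) (hne a ha)
  | pos => exact fun a ha => lt_of_le_of_ne (h a ha) (hne a ha).symm

theorem eq_one_of_act_eq {A : Finset (Fin n)} {η : Fin (n + 1) →₀ ℕ}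
    (hη : DistinctOnBlocks A η) {w : Equiv.Perm (Fin (n + 1))} (hw : w ∈ parabolic A)
    (h : act w η = η) : w = 1 := by
  ext x
  have h1 : η x = η (w x) := by
    have := DFunLike.congr_fun h (w x)
    rwa [act_apply, Equiv.symm_apply_apply] at this
  rw [← hη.eq_of_sameBlock (sameBlock_apply hw x) h1, Equiv.Perm.one_apply]

/-! ### The two commuting factors of `W_{I ∪ J}` -/

theorem not_touched_of_touched {I J : Finset (Fin n)} (hIJ : Separated I J) {x : Fin (n + 1)}
    (hx : Touched I x) : ¬ Touched J x := by
  rintro ⟨j, hj, h⟩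
  obtain ⟨i, hi, h'⟩ := hx
  obtain ⟨h1, h2, h3⟩ := hIJ i hi j hj
  rw [Ne, Fin.ext_iff] at h1
  simp only [Fin.ext_iff, Fin.val_castSucc, Fin.val_succ] at h h'
  omega

theorem commute_of_separated {I J : Finset (Fin n)} (hIJ : Separated I J)
    {u v : Equiv.Perm (Fin (n + 1))} (hu : u ∈ parabolic I) (hv : v ∈ parabolic J) :
    u * v = v * u := by
  refine Equiv.Perm.Disjoint.commute (fun x => ?_)
  by_cases hx : Touched I x
  · exact Or.inr (apply_eq_of_not_touched hv (not_touched_of_touched hIJ hx))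
  · exact Or.inl (apply_eq_of_not_touched hu hx)

theorem eq_one_of_mem_of_mem {I J : Finset (Fin n)} (hIJ : Separated I J)
    {w : Equiv.Perm (Fin (n + 1))} (hI : w ∈ parabolic I) (hJ : w ∈ parabolic J) : w = 1 := by
  ext x
  by_cases hx : Touched I x
  · rw [apply_eq_of_not_touched hJ (not_touched_of_touched hIJ hx), Equiv.Perm.one_apply]
  · rw [apply_eq_of_not_touched hI hx, Equiv.Perm.one_apply]

/-- Letters from `J` commute past those from `I`, and the sign of the `J`-part counts its letters
mod 2. This is what makes `detJ` independent of the decomposition. -/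
theorem exists_mul_of_list {I J : Finset (Fin n)} (hIJ : Separated I J) (l : List (Fin n))
    (hl : ∀ i ∈ l, i ∈ I ∪ J) :
    ∃ u ∈ parabolic I, ∃ v ∈ parabolic J, (l.map simple).prod = u * v ∧
      (Equiv.Perm.sign v : ℤ) = (-1) ^ l.countP (fun i => i ∈ J) := by
  induction l with
  | nil => exact ⟨1, one_mem _, 1, one_mem _, by simp, by simp⟩
  | cons a l ih =>
    obtain ⟨u, hu, v, hv, h1, h2⟩ := ih fun i hi => hl i (List.mem_cons_of_mem _ hi)
    rcases Finset.mem_union.mp (hl a List.mem_cons_self) with ha | ha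
    · have haJ : a ∉ J := fun h => (hIJ a ha a h).1 rfl
      refine ⟨simple a * u, mul_mem (simple_mem_parabolic ha) hu, v, hv, ?_, ?_⟩
      · rw [List.map_cons, List.prod_cons, h1, mul_assoc]
      · rw [h2, List.countP_cons_of_neg (by simpa using haJ)]
    · refine ⟨u, hu, simple a * v, mul_mem (simple_mem_parabolic ha) hv, ?_, ?_⟩
      · rw [List.map_cons, List.prod_cons, h1, ← mul_assoc, ← mul_assoc,
          commute_of_separated hIJ hu (simple_mem_parabolic ha)]
      · have hs : Equiv.Perm.sign (simple a) = -1 :=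
          Equiv.Perm.sign_swap (Fin.castSucc_lt_succ (i := a)).ne
        rw [map_mul, hs, List.countP_cons_of_pos (by simpa using ha), pow_succ, ← h2]
        simp

theorem exists_list_of_mem {A : Finset (Fin n)} {w : Equiv.Perm (Fin (n + 1))}
    (hw : w ∈ parabolic A) : ∃ l : List (Fin n), (∀ i ∈ l, i ∈ A) ∧ (l.map simple).prod = w := by
  refine parabolic_induction (p := fun w => ∃ l : List (Fin n), (∀ i ∈ l, i ∈ A) ∧
    (l.map simple).prod = w) ⟨[], by simp, by simp⟩ (fun a ha w _ ih => ?_) hw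
  obtain ⟨l, h1, h2⟩ := ih
  exact ⟨a :: l, by simpa [ha] using h1, by simp [h2]⟩

theorem exists_mul_of_mem {I J : Finset (Fin n)} (hIJ : Separated I J)
    {w : Equiv.Perm (Fin (n + 1))} (hw : w ∈ parabolic (I ∪ J)) :
    ∃ u ∈ parabolic I, ∃ v ∈ parabolic J, w = u * v := by
  obtain ⟨l, hl, rfl⟩ := exists_list_of_mem hw
  obtain ⟨u, hu, v, hv, h, -⟩ := exists_mul_of_list hIJ l hl
  exact ⟨u, hu, v, hv, h⟩

theorem mul_mem_parabolic_union {I J : Finset (Fin n)} {u v : Equiv.Perm (Fin (n + 1))}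
    (hu : u ∈ parabolic I) (hv : v ∈ parabolic J) : u * v ∈ parabolic (I ∪ J) :=
  mul_mem (parabolic_mono Finset.subset_union_left hu)
    (parabolic_mono Finset.subset_union_right hv)

theorem mul_right_unique {I J : Finset (Fin n)} (hIJ : Separated I J)
    {u u' v v' : Equiv.Perm (Fin (n + 1))} (hu : u ∈ parabolic I) (hu' : u' ∈ parabolic I)
    (hv : v ∈ parabolic J) (hv' : v' ∈ parabolic J) (h : u * v = u' * v') : v = v' := by
  have h1 : u'⁻¹ * u = v' * v⁻¹ := by
    rw [inv_mul_eq_iff_eq_mul, ← mul_assoc, ← h, mul_inv_cancel_right]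
  have h2 := eq_one_of_mem_of_mem hIJ (mul_mem (inv_mem hu') hu)
    (by rw [h1]; exact mul_mem hv' (inv_mem hv))
  rw [h1, mul_inv_eq_one] at h2
  exact h2.symm

theorem detJ_mul {I J : Finset (Fin n)} (hIJ : Separated I J)
    {u v : Equiv.Perm (Fin (n + 1))} (hu : u ∈ parabolic I) (hv : v ∈ parabolic J) :
    detJ I J (u * v) = (Equiv.Perm.sign v : ℤ) := by
  have key : ∀ l : List (Fin n), (∀ i ∈ l, i ∈ I ∪ J) → (l.map simple).prod = u * v →
      (Equiv.Perm.sign v : ℤ) = (-1) ^ l.countP (fun i => i ∈ J) := by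
    intro l hl h
    obtain ⟨u', hu', v', hv', h1, h2⟩ := exists_mul_of_list hIJ l hl
    rw [mul_right_unique hIJ hu hu' hv hv' (h.symm.trans h1), h2]
  obtain ⟨l, hl, h⟩ := exists_list_of_mem (mul_mem_parabolic_union hu hv)
  have hl' := key l hl h
  unfold detJ
  split_ifs with hex
  · obtain ⟨l', h1, h2, h3⟩ := hex
    rw [key l' h1 h2, Even.neg_one_pow]
    convert h3
  · rw [hl', Odd.neg_one_pow]
    rw [← Nat.not_even_iff_odd]
    intro he
    exact hex ⟨l, hl, h, by convert he⟩

theorem act_act_of_touched_left {I J : Finset (Fin n)} (hIJ : Separated I J)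
    {u v : Equiv.Perm (Fin (n + 1))} (hu : u ∈ parabolic I) (hv : v ∈ parabolic J)
    (η : Fin (n + 1) →₀ ℕ) {x : Fin (n + 1)} (hx : Touched I x) :
    act (u * v) η x = act u η x := by
  rw [commute_of_separated hIJ hu hv, act_mul,
    act_apply_of_not_touched hv _ (not_touched_of_touched hIJ hx)]

theorem act_act_of_not_touched_left {I : Finset (Fin n)}
    {u v : Equiv.Perm (Fin (n + 1))} (hu : u ∈ parabolic I)
    (η : Fin (n + 1) →₀ ℕ) {x : Fin (n + 1)} (hx : ¬ Touched I x) :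
    act (u * v) η x = act v η x := by
  rw [act_mul, act_apply_of_not_touched hu _ hx]

/-- The two factors move disjoint sets of positions, so an equality of rearrangements splits. -/
theorem act_mul_eq {I J : Finset (Fin n)} (hIJ : Separated I J)
    {u u' v v' : Equiv.Perm (Fin (n + 1))} (hu : u ∈ parabolic I) (hu' : u' ∈ parabolic I)
    (hv : v ∈ parabolic J) (hv' : v' ∈ parabolic J) {η : Fin (n + 1) →₀ ℕ}
    (h : act (u * v) η = act (u' * v') η) : act u η = act u' η ∧ act v η = act v' η := by
  constructor
  · ext x
    by_cases hx : Touched I x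
    · rw [← act_act_of_touched_left hIJ hu hv η hx, h, act_act_of_touched_left hIJ hu' hv' η hx]
    · rw [act_apply_of_not_touched hu _ hx, act_apply_of_not_touched hu' _ hx]
  · ext x
    by_cases hx : Touched I x
    · rw [act_apply_of_not_touched hv _ (not_touched_of_touched hIJ hx),
        act_apply_of_not_touched hv' _ (not_touched_of_touched hIJ hx)]
    · have := DFunLike.congr_fun h x
      rwa [act_mul, act_mul, act_apply_of_not_touched hu _ hx,
        act_apply_of_not_touched hu' _ hx] at this

/-! ### Existence and uniqueness of the rearranged compositions -/

theorem OrderedOnI.congr {A : Finset (Fin n)} {η κ κ' : Fin (n + 1) →₀ ℕ} {ε : SignType}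
    (hκ : ∀ x, Touched A x → κ x = κ' x) (h : OrderedOnI A η κ ε) : OrderedOnI A η κ' ε := by
  have h1 : ∀ a ∈ A, κ a.castSucc = κ' a.castSucc := fun a ha => hκ _ ⟨a, ha, Or.inl rfl⟩
  have h2 : ∀ a ∈ A, κ a.succ = κ' a.succ := fun a ha => hκ _ ⟨a, ha, Or.inr rfl⟩
  cases ε <;> intro a ha <;> rw [← h1 a ha, ← h2 a ha] <;> exact h a ha

theorem OrderedOnJ.congr {A : Finset (Fin n)} {η κ κ' : Fin (n + 1) →₀ ℕ} {ε : SignType}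
    (hκ : ∀ x, Touched A x → κ x = κ' x) (h : OrderedOnJ A η κ ε) : OrderedOnJ A η κ' ε := by
  have h1 : ∀ a ∈ A, κ a.castSucc = κ' a.castSucc := fun a ha => hκ _ ⟨a, ha, Or.inl rfl⟩
  have h2 : ∀ a ∈ A, κ a.succ = κ' a.succ := fun a ha => hκ _ ⟨a, ha, Or.inr rfl⟩
  cases ε <;> intro a ha <;> rw [← h1 a ha, ← h2 a ha] <;> exact h a ha

/-- Each order condition sees only the positions touched by its own factor, so uniqueness reduces to
`W_I` and `W_J` separately. -/
theorem isRearranged_iff {I J : Finset (Fin n)} (hIJ : Separated I J) {η : Fin (n + 1) →₀ ℕ}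
    {εI εJ : SignType} {u v : Equiv.Perm (Fin (n + 1))} (hu : u ∈ parabolic I)
    (hv : v ∈ parabolic J) (hu' : OrderedOnI I η (act u η) εI)
    (hv' : OrderedOnJ J η (act v η) εJ) (κ : Fin (n + 1) →₀ ℕ) :
    IsRearranged I J η εI εJ κ ↔ κ = act (u * v) η := by
  have hJI : ∀ x, Touched J x → ¬ Touched I x := fun x h h' => not_touched_of_touched hIJ h' h
  constructor
  · rintro ⟨⟨w, hw, rfl⟩, h1, h2⟩
    obtain ⟨u', hu'', v', hv'', rfl⟩ := exists_mul_of_mem hIJ hw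
    have e1 := act_eq_of_orderedOnI hu'' hu
      (h1.congr fun x hx => act_act_of_touched_left hIJ hu'' hv'' η hx) hu'
    have e2 := act_eq_of_orderedOnI hv'' hv (h2.congr fun x hx =>
      act_act_of_not_touched_left hu'' η (hJI x hx)).orderedOnI hv'.orderedOnI
    rw [act_mul, e2, ← act_mul, commute_of_separated hIJ hu'' hv, act_mul, e1, ← act_mul,
      commute_of_separated hIJ hu hv]
  · rintro rfl
    exact ⟨⟨_, mul_mem_parabolic_union hu hv, rfl⟩,
      hu'.congr fun x hx => (act_act_of_touched_left hIJ hu hv η hx).symm,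
      hv'.congr fun x hx => (act_act_of_not_touched_left hu η (hJI x hx)).symm⟩

theorem rearranged_eq {I J : Finset (Fin n)} (hIJ : Separated I J) {η : Fin (n + 1) →₀ ℕ}
    {εI εJ : SignType} {u v : Equiv.Perm (Fin (n + 1))} (hu : u ∈ parabolic I)
    (hv : v ∈ parabolic J) (hu' : OrderedOnI I η (act u η) εI)
    (hv' : OrderedOnJ J η (act v η) εJ) : rearranged I J η εI εJ = act (u * v) η :=
  (isRearranged_iff hIJ hu hv hu' hv' _).mp
    (Classical.epsilon_spec ⟨_, (isRearranged_iff hIJ hu hv hu' hv' _).mpr rfl⟩)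

theorem existsUnique_isRearranged {I J : Finset (Fin n)} (hIJ : Separated I J)
    {η : Fin (n + 1) →₀ ℕ} (hη : DistinctOnBlocks J η) (εI εJ : SignType) :
    ∃! κ, IsRearranged I J η εI εJ κ := by
  obtain ⟨u, hu, hu'⟩ := exists_orderedOnI I η εI
  obtain ⟨v, hv, hv'⟩ := exists_orderedOnJ hη εJ
  exact ⟨_, (isRearranged_iff hIJ hu hv hu' hv' _).mpr rfl,
    fun κ h => (isRearranged_iff hIJ hu hv hu' hv' κ).mp h⟩

/-- Rearranging a composition that is weakly decreasing along `A` makes it smaller. -/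
theorem act_eq_or_precedes {A : Finset (Fin n)} {κ : Fin (n + 1) →₀ ℕ}
    (hκ : ∀ a ∈ A, κ a.succ ≤ κ a.castSucc) {w : Equiv.Perm (Fin (n + 1))}
    (hw : w ∈ parabolic A) : act w κ = κ ∨ Precedes (act w κ) κ := by
  by_cases h : act w κ = κ
  · exact Or.inl h
  · refine Or.inr (Or.inr ⟨sortDesc_act _ _, fun h' => h (DFunLike.coe_injective h'),
      sum_act _ _, fun q => ?_⟩)
    have := partialSum_comp_le (f := fun x => (κ x : ℤ)) (fun a ha => by exact_mod_cast hκ a ha)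
      (inv_mem hw) q
    unfold partialSum at this
    simp only [Function.comp] at this
    exact_mod_cast this

/-- Nothing in its orbit precedes a composition that is weakly increasing along `A`. -/
theorem not_precedes_of_increasing {A : Finset (Fin n)} {κ : Fin (n + 1) →₀ ℕ}
    (hκ : ∀ a ∈ A, κ a.castSucc ≤ κ a.succ) {w : Equiv.Perm (Fin (n + 1))}
    (hw : w ∈ parabolic A) : ¬ Precedes (act w κ) κ := by
  rintro (h | ⟨-, h⟩)
  · exact h.1 (sortDesc_act _ _)
  · refine h.1 (partialSum_injective fun q => le_antisymm (h.2.2 q) ?_)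
    have := partialSum_comp_le (f := fun x => -(κ x : ℤ))
      (fun a ha => by simpa using hκ a ha) (inv_mem hw) q
    unfold partialSum at this
    simp only [Function.comp, Finset.sum_neg_distrib, neg_le_neg_iff] at this
    exact_mod_cast this

end PrescribedJack

namespace PrescribedJack

variable {K : Type*} [Field K] {n : ℕ}

/-! ### The operator `O_{I,J}` -/

theorem detJ_mul_of_mem {I J : Finset (Fin n)} (hIJ : Separated I J)
    {w w' : Equiv.Perm (Fin (n + 1))} (hw : w ∈ parabolic (I ∪ J))
    (hw' : w' ∈ parabolic (I ∪ J)) : detJ I J (w * w') = detJ I J w * detJ I J w' := by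
  obtain ⟨u, hu, v, hv, rfl⟩ := exists_mul_of_mem hIJ hw
  obtain ⟨u', hu', v', hv', rfl⟩ := exists_mul_of_mem hIJ hw'
  have : u * v * (u' * v') = u * u' * (v * v') := by
    rw [mul_assoc, ← mul_assoc v, ← commute_of_separated hIJ hu' hv, mul_assoc, mul_assoc]
  rw [this, detJ_mul hIJ (mul_mem hu hu') (mul_mem hv hv'), detJ_mul hIJ hu hv,
    detJ_mul hIJ hu' hv', map_mul, Units.val_mul]

theorem detJ_simple_left {I J : Finset (Fin n)} (hIJ : Separated I J) {a : Fin n} (ha : a ∈ I) :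
    detJ I J (simple a) = 1 := by
  have := detJ_mul hIJ (simple_mem_parabolic ha) (one_mem (parabolic J))
  simpa using this

theorem detJ_of_mem_right {I J : Finset (Fin n)} (hIJ : Separated I J)
    {v : Equiv.Perm (Fin (n + 1))} (hv : v ∈ parabolic J) :
    detJ I J v = (Equiv.Perm.sign v : ℤ) := by
  have := detJ_mul hIJ (one_mem (parabolic I)) hv
  rwa [one_mul] at this

theorem sign_simple (a : Fin n) : Equiv.Perm.sign (simple a) = -1 :=
  Equiv.Perm.sign_swap (Fin.castSucc_lt_succ (i := a)).ne

theorem detJ_simple_right {I J : Finset (Fin n)} (hIJ : Separated I J) {a : Fin n} (ha : a ∈ J) :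
    detJ I J (simple a) = -1 := by
  rw [detJ_of_mem_right hIJ (simple_mem_parabolic ha), sign_simple]; rfl

open Classical in
theorem symAsym_rename_simple {I J : Finset (Fin n)} (hIJ : Separated I J) {a : Fin n}
    (ha : a ∈ I ∪ J) (f : MvPolynomial (Fin (n + 1)) K) :
    symAsym I J (rename (simple a) f) = C ((detJ I J (simple a) : ℤ) : K) * symAsym I J f := by
  have hs := simple_mem_parabolic ha
  unfold symAsym
  rw [Finset.mul_sum]
  refine Finset.sum_bij' (fun w _ => w * simple a) (fun w _ => w * simple a) ?_ ?_ ?_ ?_ ?_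
  · intro w hw; simpa using mul_mem (by simpa using hw) hs
  · intro w hw; simpa using mul_mem (by simpa using hw) hs
  · intro w _; rw [mul_assoc, simple_mul_self, mul_one]
  · intro w _; rw [mul_assoc, simple_mul_self, mul_one]
  · intro w hw
    have hw : w ∈ parabolic (I ∪ J) := by simpa using hw
    have h : detJ I J (simple a) * detJ I J (w * simple a) = detJ I J w := by
      rw [mul_comm, ← detJ_mul_of_mem hIJ (mul_mem hw hs) hs, mul_assoc, simple_mul_self, mul_one]
    rw [← h, rename_rename, ← mul_assoc, ← C_mul, ← Int.cast_mul, Equiv.Perm.coe_mul]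

open Classical in
theorem rename_simple_symAsym {I J : Finset (Fin n)} (hIJ : Separated I J) {a : Fin n}
    (ha : a ∈ I ∪ J) (f : MvPolynomial (Fin (n + 1)) K) :
    rename (simple a) (symAsym I J f) = C ((detJ I J (simple a) : ℤ) : K) * symAsym I J f := by
  have hs := simple_mem_parabolic ha
  unfold symAsym
  rw [Finset.mul_sum, map_sum]
  refine Finset.sum_bij' (fun w _ => simple a * w) (fun w _ => simple a * w) ?_ ?_ ?_ ?_ ?_
  · intro w hw; simpa using mul_mem hs (by simpa using hw)
  · intro w hw; simpa using mul_mem hs (by simpa using hw)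
  · intro w _; rw [← mul_assoc, simple_mul_self, one_mul]
  · intro w _; rw [← mul_assoc, simple_mul_self, one_mul]
  · intro w hw
    have hw : w ∈ parabolic (I ∪ J) := by simpa using hw
    have h : detJ I J (simple a) * detJ I J (simple a * w) = detJ I J w := by
      rw [← detJ_mul_of_mem hIJ hs (mul_mem hs hw), ← mul_assoc, simple_mul_self, one_mul]
    rw [← h, map_mul, rename_C, rename_rename, ← mul_assoc, ← C_mul, ← Int.cast_mul,
      Equiv.Perm.coe_mul]

theorem symAsym_add (I J : Finset (Fin n)) (f g : MvPolynomial (Fin (n + 1)) K) :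
    symAsym I J (f + g) = symAsym I J f + symAsym I J g := by
  simp only [symAsym, map_add, mul_add, Finset.sum_add_distrib]

theorem symAsym_C_mul (I J : Finset (Fin n)) (c : K) (f : MvPolynomial (Fin (n + 1)) K) :
    symAsym I J (C c * f) = C c * symAsym I J f := by
  simp only [symAsym, map_mul, rename_C, Finset.mul_sum]
  exact Finset.sum_congr rfl fun w _ => mul_left_comm _ _ _

/-! ### `O_{I,J} E` along an orbit -/

section
variable {α : K} {I J : Finset (Fin n)}

theorem symAsym_nonsymJack_act_simple_of_lt (hα : ∀ a b : ℕ, 0 < a → (a : K) * α + (b : K) ≠ 0)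
    (hIJ : Separated I J) {a : Fin n} (ha : a ∈ I ∪ J) {κ : Fin (n + 1) →₀ ℕ}
    (h : κ a.castSucc < κ a.succ) :
    symAsym I J (nonsymJack α (act (simple a) κ))
      = C (((detJ I J (simple a) : ℤ) : K)
          + (eigenvalue α κ a.succ - eigenvalue α κ a.castSucc)⁻¹)
        * symAsym I J (nonsymJack α κ) := by
  have h1 := rename_simple_nonsymJack_of_lt hα h
  rw [eq_sub_iff_add_eq] at h1
  rw [← h1, symAsym_add, symAsym_C_mul, symAsym_rename_simple hIJ ha, C_add, add_mul]

/-- The factor is `1 + δ⁻¹ = (δ + 1)/δ`, which is `d_κ / d_{s_aκ}` when `κ_a < κ_{a+1}`; the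
opposite case follows since `s_a` is an involution. -/
theorem symAsym_nonsymJack_act_simple_left
    (hα : ∀ a b : ℕ, 0 < a → (a : K) * α + (b : K) ≠ 0)
    (hIJ : Separated I J) {a : Fin n} (ha : a ∈ I) (κ : Fin (n + 1) →₀ ℕ) :
    C (d α (act (simple a) κ)) * symAsym I J (nonsymJack α (act (simple a) κ))
      = C (d α κ) * symAsym I J (nonsymJack α κ) := by
  have key : ∀ κ : Fin (n + 1) →₀ ℕ, κ a.castSucc < κ a.succ →
      C (d α (act (simple a) κ)) * symAsym I J (nonsymJack α (act (simple a) κ))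
        = C (d α κ) * symAsym I J (nonsymJack α κ) := by
    intro κ h
    rw [symAsym_nonsymJack_act_simple_of_lt hα hIJ (Finset.mem_union_left _ ha) h,
      detJ_simple_left hIJ ha, ← mul_assoc, ← C_mul]
    have hδ := eigenvalue_sub_ne_zero hα h
    have hd := d_act_simple α h
    congr 2
    field_simp
    push_cast
    linear_combination -hd
  rcases lt_trichotomy (κ a.castSucc) (κ a.succ) with h | h | h
  · exact key κ h
  · have : act (simple a) κ = κ := act_swap_of_eq h
    rw [this]
  · have h1 := key (act (simple a) κ) (by rwa [act_simple_castSucc, act_simple_succ])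
    rw [act_simple_act_simple] at h1
    exact h1.symm

/-- The factor is `-1 + δ⁻¹ = -(δ - 1)/δ = -d'_{s_aκ} / d'_κ` when `κ_a < κ_{a+1}`. For equal
entries `s_a` fixes `E_κ`, so `O E_κ` is its own negative and vanishes in characteristic `0`. -/
theorem symAsym_nonsymJack_act_simple_right [CharZero K]
    (hα : ∀ a b : ℕ, 0 < a → (a : K) * α + (b : K) ≠ 0)
    (hIJ : Separated I J) {a : Fin n} (ha : a ∈ J) (κ : Fin (n + 1) →₀ ℕ) :
    C (d' α κ) * symAsym I J (nonsymJack α (act (simple a) κ))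
      = -(C (d' α (act (simple a) κ)) * symAsym I J (nonsymJack α κ)) := by
  have key : ∀ κ : Fin (n + 1) →₀ ℕ, κ a.castSucc < κ a.succ →
      C (d' α κ) * symAsym I J (nonsymJack α (act (simple a) κ))
      = -(C (d' α (act (simple a) κ)) * symAsym I J (nonsymJack α κ)) := by
    intro κ h
    rw [symAsym_nonsymJack_act_simple_of_lt hα hIJ (Finset.mem_union_right _ ha) h,
      detJ_simple_right hIJ ha, ← mul_assoc, ← C_mul, ← neg_mul, ← C_neg]
    have hδ := eigenvalue_sub_ne_zero hα h
    have hd := d'_act_simple α h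
    congr 2
    field_simp
    push_cast
    linear_combination -hd
  rcases lt_trichotomy (κ a.castSucc) (κ a.succ) with h | h | h
  · exact key κ h
  · have hact : act (simple a) κ = κ := act_swap_of_eq h
    have h1 := symAsym_rename_simple hIJ (Finset.mem_union_right I ha) (nonsymJack α κ)
    rw [rename_simple_nonsymJack_of_eq hα h, detJ_simple_right hIJ ha] at h1
    have h2 : symAsym I J (nonsymJack α κ) = 0 := by
      simpa [self_eq_neg] using h1
    rw [hact, h2]; simp
  · have h1 := key (act (simple a) κ) (by rwa [act_simple_castSucc, act_simple_succ])
    rw [act_simple_act_simple] at h1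
    rw [h1, neg_neg]

theorem symAsym_nonsymJack_act_left (hα : ∀ a b : ℕ, 0 < a → (a : K) * α + (b : K) ≠ 0)
    (hIJ : Separated I J) {u : Equiv.Perm (Fin (n + 1))} (hu : u ∈ parabolic I)
    (κ : Fin (n + 1) →₀ ℕ) :
    C (d α (act u κ)) * symAsym I J (nonsymJack α (act u κ))
      = C (d α κ) * symAsym I J (nonsymJack α κ) := by
  refine parabolic_induction (p := fun u => C (d α (act u κ)) * symAsym I J
    (nonsymJack α (act u κ)) = C (d α κ) * symAsym I J (nonsymJack α κ))
    (by rw [act_one]) (fun a ha w _ ih => ?_) hu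
  rw [act_mul, symAsym_nonsymJack_act_simple_left hα hIJ ha, ih]

theorem symAsym_nonsymJack_act_right [CharZero K]
    (hα : ∀ a b : ℕ, 0 < a → (a : K) * α + (b : K) ≠ 0)
    (hIJ : Separated I J) {v : Equiv.Perm (Fin (n + 1))} (hv : v ∈ parabolic J)
    (κ : Fin (n + 1) →₀ ℕ) :
    C (d' α κ) * symAsym I J (nonsymJack α (act v κ))
      = C (((Equiv.Perm.sign v : ℤ) : K) * d' α (act v κ)) * symAsym I J (nonsymJack α κ) := by
  refine parabolic_induction (p := fun v => C (d' α κ) * symAsym I J (nonsymJack α (act v κ))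
      = C (((Equiv.Perm.sign v : ℤ) : K) * d' α (act v κ)) * symAsym I J (nonsymJack α κ))
    (by simp) (fun a ha w _ ih => ?_) hv
  have h1 := symAsym_nonsymJack_act_simple_right hα hIJ ha (act w κ)
  have h0 : (C (d' α (act w κ)) : MvPolynomial (Fin (n + 1)) K) ≠ 0 := by
    rw [Ne, C_eq_zero]; exact d'_ne_zero hα _
  refine mul_left_cancel₀ h0 ?_
  rw [act_mul, Equiv.Perm.sign_mul, sign_simple]
  simp only [Units.val_mul, Units.val_neg, Units.val_one, Int.cast_mul, Int.cast_neg, Int.cast_one,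
    C_mul, C_neg, C_1] at ih ⊢
  linear_combination (C (d' α κ)) * h1 - C (d' α (act (simple a) (act w κ))) * ih

/-! ### Leading terms -/

/-- The coefficient of the largest monomial of the orbit in `O_{I,J} E_κ`, for `κ` the smallest
composition of the orbit. -/
theorem coeff_symAsym_nonsymJack (hα : ∀ a b : ℕ, 0 < a → (a : K) * α + (b : K) ≠ 0)
    (hIJ : Separated I J) {η : Fin (n + 1) →₀ ℕ} (hη : DistinctOnBlocks J η)
    {u u' v v' : Equiv.Perm (Fin (n + 1))} (hu : u ∈ parabolic I) (hu' : u' ∈ parabolic I)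
    (hv : v ∈ parabolic J) (hv' : v' ∈ parabolic J)
    (hmin : ∀ a ∈ I ∪ J, act (u' * v') η a.castSucc ≤ act (u' * v') η a.succ) :
    coeff (act (u * v) η) (symAsym I J (nonsymJack α (act (u' * v') η)))
      = ((Equiv.Perm.sign (v * v'⁻¹) : ℤ) : K) * (stabCard I η : K) := by
  classical
  set κ := act (u' * v') η with hκ
  have hE := nonsymJack_spec hα κ
  have hw' := mul_mem_parabolic_union hu' hv'
  have hw := mul_mem_parabolic_union hu hv
  -- `κ` is minimal in its orbit, so `z^κ` is the only monomial of the orbit in `E_κ`; thus `w E_κ`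
  -- contributes only when `wκ` is the target composition.
  have hterm : ∀ w ∈ parabolic (I ∪ J), coeff (act (u * v) η) (rename w (nonsymJack α κ))
      = if act w κ = act (u * v) η then 1 else 0 := by
    intro w hwm
    have h1 : act (u * v) η = act w (act (w⁻¹ * (u * v) * (u' * v')⁻¹) κ) := by
      rw [hκ, ← act_mul, ← act_mul]; congr 1; group
    split_ifs with h
    · rw [← h, coeff_rename_perm, hE.1.1]
    · rw [h1, coeff_rename_perm]
      by_contra h0
      refine not_precedes_of_increasing hmin
        (mul_mem (mul_mem (inv_mem hwm) hw) (inv_mem hw')) (hE.1.2 _ (fun h2 => h ?_) h0)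
      rw [h1, h2]
  have hsum : coeff (act (u * v) η) (symAsym I J (nonsymJack α κ))
      = ∑ w ∈ Finset.univ.filter (fun w => w ∈ parabolic (I ∪ J) ∧ act w κ = act (u * v) η),
        ((detJ I J w : ℤ) : K) := by
    rw [symAsym, coeff_sum, ← Finset.filter_filter, Finset.sum_filter
      (fun w => act w κ = act (u * v) η)]
    refine Finset.sum_congr (by ext; simp) fun w hwm => ?_
    rw [coeff_C_mul, hterm w (by simpa using hwm), mul_ite, mul_one, mul_zero]
  have hsum' : ∑ w ∈ Finset.univ.filter
        (fun w => w ∈ parabolic (I ∪ J) ∧ act w κ = act (u * v) η), ((detJ I J w : ℤ) : K)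
      = ∑ σ ∈ Finset.univ.filter (fun σ => σ ∈ parabolic I ∧ act σ η = η),
        ((Equiv.Perm.sign (v * v'⁻¹) : ℤ) : K) := by
    symm
    -- The `J`-part of a contributing `w` is forced to be `v v'⁻¹`, since the entries are distinct
    -- on the blocks; its `I`-part is determined up to the stabilizer of `η` in `W_I`.
    refine Finset.sum_nbij (fun σ => (u * σ * u'⁻¹) * (v * v'⁻¹)) ?_ ?_ ?_ ?_
    · intro σ hσ
      simp only [Finset.mem_filter, Finset.mem_univ, true_and] at hσ ⊢
      have hm := mul_mem (mul_mem hu hσ.1) (inv_mem hu')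
      refine ⟨mul_mem_parabolic_union hm (mul_mem hv (inv_mem hv')), ?_⟩
      have e : u * σ * u'⁻¹ * (v * v'⁻¹) * (u' * v') = u * v * σ := by
        rw [mul_assoc _ _ (u' * v'), ← mul_assoc (v * v'⁻¹),
          ← commute_of_separated hIJ hu' (mul_mem hv (inv_mem hv')), mul_assoc u v,
          ← commute_of_separated hIJ hσ.1 hv]
        group
      rw [hκ, ← act_mul, e, act_mul, hσ.2]
    · intro σ _ σ' _ h
      simpa using h
    · intro w hwm
      simp only [Finset.coe_filter, Finset.mem_univ, true_and, Set.mem_ofPred_eq] at hwm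
      obtain ⟨hwm, hact⟩ := hwm
      obtain ⟨a, ha, b, hb, rfl⟩ := exists_mul_of_mem hIJ hwm
      have hau := mul_mem ha hu'
      have hbv := mul_mem hb hv'
      have e : a * b * (u' * v') = a * u' * (b * v') := by
        rw [mul_assoc, ← mul_assoc b, ← commute_of_separated hIJ hu' hb, mul_assoc, mul_assoc]
      rw [hκ, ← act_mul, e] at hact
      obtain ⟨h1, h2⟩ := act_mul_eq hIJ hau hu hbv hv hact
      have h3 : v⁻¹ * (b * v') = 1 := eq_one_of_act_eq hη (mul_mem (inv_mem hv) hbv) (by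
        rw [act_mul, h2, ← act_mul, inv_mul_cancel, act_one])
      have h4 : b = v * v'⁻¹ := by
        rw [inv_mul_eq_one] at h3
        rw [h3, mul_inv_cancel_right]
      refine ⟨u⁻¹ * (a * u'), ?_, ?_⟩
      · simp only [Finset.coe_filter, Finset.mem_univ, true_and, Set.mem_ofPred_eq]
        exact ⟨mul_mem (inv_mem hu) hau, by
          rw [act_mul, h1, ← act_mul, inv_mul_cancel, act_one]⟩
      · simp only [h4]
        group
    · intro σ hσ
      simp only [Finset.mem_filter, Finset.mem_univ, true_and] at hσ
      rw [detJ_mul hIJ (mul_mem (mul_mem hu hσ.1) (inv_mem hu')) (mul_mem hv (inv_mem hv'))]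
  rw [hsum, hsum', Finset.sum_const, nsmul_eq_mul, mul_comm, stabCard, Nat.card_eq_fintype_card,
    Fintype.card_subtype]

theorem stabCard_ne_zero (I : Finset (Fin n)) (η : Fin (n + 1) →₀ ℕ) : stabCard I η ≠ 0 := by
  have : Nonempty {σ : Equiv.Perm (Fin (n + 1)) // σ ∈ parabolic I ∧ act σ η = η} :=
    ⟨⟨1, one_mem _, act_one η⟩⟩
  exact Nat.card_pos.ne'

/-- The span of the `E_{wη}` is stable under each `s_a`, `a ∈ A`, by
`rename_simple_nonsymJack_mem_span`. -/
theorem rename_nonsymJack_mem_span (hα : ∀ a b : ℕ, 0 < a → (a : K) * α + (b : K) ≠ 0)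
    {A : Finset (Fin n)} (η : Fin (n + 1) →₀ ℕ) {w : Equiv.Perm (Fin (n + 1))}
    (hw : w ∈ parabolic A) :
    rename w (nonsymJack α η)
      ∈ Submodule.span K ((fun w => nonsymJack α (act w η)) '' (parabolic A : Set _)) := by
  refine parabolic_induction (p := fun w => rename w (nonsymJack α η) ∈ Submodule.span K
    ((fun w => nonsymJack α (act w η)) '' (parabolic A : Set _))) ?_ (fun a ha w _ ih => ?_) hw
  · refine Submodule.subset_span ⟨1, one_mem _, ?_⟩
    simp only [act_one, Equiv.Perm.coe_one, rename_id_apply]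
  · rw [Equiv.Perm.coe_mul, ← rename_rename]
    generalize rename w (nonsymJack α η) = g at ih ⊢
    induction ih using Submodule.span_induction with
    | mem x hx =>
      obtain ⟨v, hv, rfl⟩ := hx
      obtain ⟨c, c', h⟩ := rename_simple_nonsymJack_mem_span hα a (act v η)
      simp only [h, ← smul_eq_C_mul]
      refine Submodule.add_mem _ (Submodule.smul_mem _ _ (Submodule.subset_span ⟨v, hv, rfl⟩))
        (Submodule.smul_mem _ _ (Submodule.subset_span
          ⟨simple a * v, mul_mem (simple_mem_parabolic ha) hv, ?_⟩))
      simp only [act_mul]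
    | zero => rw [map_zero]; exact Submodule.zero_mem _
    | add x y _ _ hx hy => rw [map_add]; exact Submodule.add_mem _ hx hy
    | smul c x _ hx => rw [map_smul]; exact Submodule.smul_mem _ _ hx

/-- `O E_κ` lies in the span of the `E_{wκ}`. The monomials of each are bounded by `wκ`, and `wκ` by
`κ`, the largest composition of the orbit. Going through the span is needed because permuting a
monomial below `κ` can destroy the bound. -/
theorem precedes_of_coeff_symAsym_ne_zero (hα : ∀ a b : ℕ, 0 < a → (a : K) * α + (b : K) ≠ 0)
    {κ : Fin (n + 1) →₀ ℕ} (hκ : ∀ a ∈ I ∪ J, κ a.succ ≤ κ a.castSucc) {ν : Fin (n + 1) →₀ ℕ}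
    (hne : ν ≠ κ) (hν : coeff ν (symAsym I J (nonsymJack α κ)) ≠ 0) : Precedes ν κ := by
  classical
  by_contra hlt
  have hle : Submodule.span K ((fun w => nonsymJack α (act w κ)) '' (parabolic (I ∪ J) : Set _))
      ≤ LinearMap.ker (lcoeff K ν) := by
    rw [Submodule.span_le]
    rintro _ ⟨w, hw, rfl⟩
    simp only [SetLike.mem_coe, LinearMap.mem_ker, lcoeff_apply]
    by_contra h
    have h1 := act_eq_or_precedes hκ hw
    have h2 := (nonsymJack_spec hα (act w κ)).1.2 ν
    by_cases h3 : ν = act w κ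
    · rw [← h3] at h1
      exact h1.elim hne hlt
    · rcases h1 with h1 | h1
      · exact hlt (h1 ▸ h2 h3 h)
      · exact hlt ((h2 h3 h).trans h1)
  refine hν ?_
  rw [symAsym, coeff_sum]
  refine Finset.sum_eq_zero fun w hw => ?_
  have := hle (rename_nonsymJack_mem_span hα κ (A := I ∪ J) (w := w) (by simpa using hw))
  rw [LinearMap.mem_ker, lcoeff_apply] at this
  rw [coeff_C_mul, this, mul_zero]

end

end PrescribedJack

/-! ### The main theorem -/

theorem proposition2 {K : Type*} [Field K] [CharZero K] (α : K)
    (hα : ∀ a b : ℕ, 0 < a → (a : K) * α + (b : K) ≠ 0)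
    (n : ℕ) (I J : Finset (Fin n)) (hIJ : Separated I J)
    (η : Fin (n + 1) →₀ ℕ) (hη : DistinctOnBlocks J η) :
    (∃! P : MvPolynomial (Fin (n + 1)) K, IsNonsymJack α η P) ∧
    (∀ εI εJ : SignType, ∃! κ : Fin (n + 1) →₀ ℕ, IsRearranged I J η εI εJ κ) ∧
    IsMonicTriangular (etaStar I J η) (prescribedJack α I J (etaStar I J η)) ∧
    (∀ i ∈ I, MvPolynomial.rename (simple i) (prescribedJack α I J (etaStar I J η)) =
      prescribedJack α I J (etaStar I J η)) ∧
    (∀ j ∈ J, MvPolynomial.rename (simple j) (prescribedJack α I J (etaStar I J η)) =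
      -prescribedJack α I J (etaStar I J η)) ∧
    (∃ wJ ∈ parabolic J, act wJ η = rearranged I J η .zero .pos) ∧
    ∀ wJ ∈ parabolic J, act wJ η = rearranged I J η .zero .pos →
      symAsym I J (nonsymJack α η) =
        MvPolynomial.C
          (((detJ I J wJ : ℤ) : K) * (stabCard I η : K) *
            ((d' α η * d' α (rearranged I J η .neg .pos) * d α (rearranged I J η .neg .pos)) /
              (d' α (rearranged I J η .zero .pos) * d α (rearranged I J η .zero .pos) *
                d' α (rearranged I J η .neg .neg)))) *
          prescribedJack α I J (etaStar I J η) := by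
  obtain ⟨uP, huP, huP'⟩ := exists_orderedOnI I η .pos
  obtain ⟨uN, huN, huN'⟩ := exists_orderedOnI I η .neg
  obtain ⟨vP, hvP, hvP'⟩ := exists_orderedOnJ hη .pos
  obtain ⟨vN, hvN, hvN'⟩ := exists_orderedOnJ hη .neg
  have hu0 : OrderedOnI I η (act 1 η) .zero := fun a _ => ⟨by rw [act_one], by rw [act_one]⟩
  have hPP : etaStar I J η = act (uP * vP) η := rearranged_eq hIJ huP hvP huP' hvP'
  have hNP := rearranged_eq hIJ huN hvP huN' hvP'
  have hNN := rearranged_eq hIJ huN hvN huN' hvN'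
  have h0P := rearranged_eq hIJ (one_mem _) hvP hu0 hvP'
  rw [one_mul] at h0P
  have hstar := (isRearranged_iff hIJ huP hvP huP' hvP' _).mpr rfl
  have hbot := (isRearranged_iff hIJ huN hvN huN' hvN' _).mpr rfl
  have hmax : ∀ a ∈ I ∪ J, act (uP * vP) η a.succ ≤ act (uP * vP) η a.castSucc := fun a ha =>
    (Finset.mem_union.mp ha).elim (hstar.2.1 a) (fun h => (hstar.2.2 a h).le)
  have hmin : ∀ a ∈ I ∪ J, act (uN * vN) η a.castSucc ≤ act (uN * vN) η a.succ := fun a ha =>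
    (Finset.mem_union.mp ha).elim (hbot.2.1 a) (fun h => (hbot.2.2 a h).le)
  rw [hPP, hNP, hNN, h0P]
  set κ := act (uP * vP) η with hκ
  set Z := coeff κ (symAsym I J (nonsymJack α κ)) with hZ
  have hdNP := d_ne_zero hα (act (uN * vP) η)
  have hdPP := d_ne_zero hα κ
  have hd0P := d_ne_zero hα (act vP η)
  have hd'NP := d'_ne_zero hα (act (uN * vP) η)
  have hd'NN := d'_ne_zero hα (act (uN * vN) η)
  have hd'0P := d'_ne_zero hα (act vP η)
  have hM : (stabCard I η : K) ≠ 0 := Nat.cast_ne_zero.mpr (stabCard_ne_zero I η)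
  have hI1 := symAsym_nonsymJack_act_left hα hIJ huP (act vP η)
  have hI2 := symAsym_nonsymJack_act_left hα hIJ huN (act vP η)
  rw [← act_mul, ← hκ] at hI1
  rw [← act_mul, ← hI1] at hI2
  -- The normalization of `O E_{η*}`: start from the known coefficient `± M_{I,η}` at `η^{(-,-)}`,
  -- pass to `η^{(-,+)}` along `W_J` through `d'`, then to `η*` along `W_I` through `d`.
  have hZval : Z * (d' α (act (uN * vN) η) * d α κ)
      = stabCard I η * (d' α (act (uN * vP) η) * d α (act (uN * vP) η)) := by
    have h1 := symAsym_nonsymJack_act_right hα hIJ (mul_mem hvN (inv_mem hvP)) (act (uN * vP) η)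
    have e : vN * vP⁻¹ * (uN * vP) = uN * vN := by
      rw [← mul_assoc, ← commute_of_separated hIJ huN (mul_mem hvN (inv_mem hvP))]
      group
    have h2 : (Equiv.Perm.sign (vP * vN⁻¹) : ℤ) = Equiv.Perm.sign (vN * vP⁻¹) := by
      simp only [map_mul, Equiv.Perm.sign_inv, mul_comm]
    rw [← act_mul, e] at h1
    have h3 := congrArg (coeff κ) h1
    have h4 := congrArg (coeff κ) hI2
    rw [coeff_C_mul, coeff_C_mul,
      coeff_symAsym_nonsymJack hα hIJ hη huP huN hvP hvN hmin, h2] at h3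
    rw [coeff_C_mul, coeff_C_mul, ← hZ] at h4
    have hs : ((Equiv.Perm.sign (vN * vP⁻¹) : ℤ) : K) ≠ 0 := by simp
    have h5 : d' α (act (uN * vP) η) * stabCard I η = d' α (act (uN * vN) η)
        * coeff κ (symAsym I J (nonsymJack α (act (uN * vP) η))) :=
      mul_left_cancel₀ hs (by linear_combination h3)
    linear_combination -(d' α (act (uN * vN) η)) * h4 - d α (act (uN * vP) η) * h5
  have hZ0 : Z ≠ 0 := by
    intro h0
    rw [h0, zero_mul] at hZval
    exact mul_ne_zero hM (mul_ne_zero hd'NP hdNP) hZval.symm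
  have hS : prescribedJack α I J κ = C Z⁻¹ * symAsym I J (nonsymJack α κ) := rfl
  refine ⟨existsUnique_isNonsymJack hα η, existsUnique_isRearranged hIJ hη, ⟨?_, ?_⟩, ?_, ?_,
    ⟨vP, hvP, rfl⟩, ?_⟩
  · rw [hS, coeff_C_mul, ← hZ, inv_mul_cancel₀ hZ0]
  · intro ν hν h
    rw [hS, coeff_C_mul] at h
    exact precedes_of_coeff_symAsym_ne_zero hα hmax hν (right_ne_zero_of_mul h)
  · intro i hi
    rw [hS, map_mul, rename_C, rename_simple_symAsym hIJ (Finset.mem_union_left _ hi),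
      detJ_simple_left hIJ hi]
    simp
  · intro j hj
    rw [hS, map_mul, rename_C, rename_simple_symAsym hIJ (Finset.mem_union_right _ hj),
      detJ_simple_right hIJ hj]
    simp
  · intro wJ hwJ hact
    have h1 := symAsym_nonsymJack_act_right hα hIJ hwJ η
    rw [hact] at h1
    rw [detJ_of_mem_right hIJ hwJ, hS]
    have hs : ((Equiv.Perm.sign wJ : ℤ) : K) * ((Equiv.Perm.sign wJ : ℤ) : K) = 1 := by
      rw [← Int.cast_mul, ← Units.val_mul, Int.units_mul_self]; simp
    set s := ((Equiv.Perm.sign wJ : ℤ) : K)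
    have hs0 : s ≠ 0 := left_ne_zero_of_mul (by rw [hs]; exact one_ne_zero)
    have hne : (C (s * d' α (act vP η) * d α (act vP η)) : MvPolynomial (Fin (n + 1)) K) ≠ 0 := by
      rw [Ne, C_eq_zero]; exact mul_ne_zero (mul_ne_zero hs0 hd'0P) hd0P
    refine mul_left_cancel₀ hne ?_
    -- The transport from `η` to `η^{(0,+)}` along `W_J` costs the sign and `d'`, the one from there
    -- to `η*` along `W_I` costs `d`; `hZval` then supplies the constant.
    have h2 : C (s * d' α (act vP η) * d α (act vP η)) * symAsym I J (nonsymJack α η)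
        = C (d' α η * d α κ) * symAsym I J (nonsymJack α κ) := by
      simp only [C_mul] at h1 ⊢
      linear_combination -(C (d α (act vP η))) * h1 - C (d' α η) * hI1
    rw [h2, ← mul_assoc, ← mul_assoc, ← C_mul, ← C_mul]
    congr 2
    field_simp
    linear_combination (d' α η) * hZval - d' α η * stabCard I η * d' α (act (uN * vP) η)
      * d α (act (uN * vP) η) * hs
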